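/- \textbf{Setting.} There are $N$ servers and a totally ordered set $C$ of clients in an asynchronous message-passing system with reliable channels (unbounded delays, arbitrary reordering). Let $K$ be a finite field, $\alpha_1,\dots,\alpha_N\in K$ pairwise distinct, $k\ge 1$, $e,f\ge 0$. The $(N,k)$ Reed--Solomon code $\Phi$ maps $m=(\sigma_1,\dots,\sigma_k)\in K^k$ to the shares $\Phi_i(m)=\sum_{j=1}^{k}\sigma_j\alpha_i^{j-1}$, $1\le i\le N$; the secret of $m$ is $\sigma_1$. Tags are the default tag $t_0$ and the pairs in $\mathbb{Z}^+\times C$, ordered lexicographically with $t_0$ below all of them. A quorum is a set of at least $\lceil (N+k+2e)/2\rceil$ servers. \textbf{Algorithm.} Each server stores records (tag, share or $\bot$, label `pre' or `fin'), initially $(t_0,\Phi_i(m_0),\text{`fin'})$. In a quorum access a client sends a request to all servers and waits for replies to it from a quorum. A \emph{write} of a secret $s$ encodes some $m\in K^k$ with first coordinate $s$ and makes three accesses: a query for the highest finalized tags (with maximum of integer part $z$, where $z=0$ for $t_0$), a pre-write of share $\Phi_i(m)$ with the new tag $(z+1,\text{client})$ at each server $i$, and a finalize request for that tag. A \emph{read}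 makes two accesses: a query, giving the maximal tag $t$, and a finalize request for $t$, to which servers reply with their share of tag $t$ or $\bot$. If at least $k+2e$ replies hold shares, the read applies the Berlekamp--Welch decoder for $e$ errors to them and returns the secret of the result; otherwise it returns $\bot$. A server stores a pre-written share unless it already has a record of that tag; on a finalize request it labels its record of that tag `fin' (or adds $(t,\bot,\text{`fin'})$) and gossips the tag to all other servers, which do the same labelling. Each client invokes its operations one after the other. \textbf{Faults.} Crashed processes stop; any number of clients may crash. Malicious servers follow the algorithm except that in their replies to clients they may put arbitrary field elements in place of the shares (or of $\bot$); they do not alter tags or labels, and do not withhold shares. An execution is fair if every message between processes that never crash is eventually delivered and every client that never crashes continues its operation after hearing from a quorum. The algorithm is \emph{$(s,t)$-robust} if in every execution with at most $s$ crashed servers and at most $t$ malicious servers (i) every finite prefix of the history of operations is linearizable with respect to a read/write register whose initial value is the secret of $m_0$ and (ii) if the execution is fair, every operation of a client that never crashes returns. \textbf{Lemma.} For every $k\in\{1,\dots,N-2(f+e)\}$ and every $m_0\in K^k$ the algorithm is $(f,e)$-robust. Moreover, in every execution with at most $f$ crashed and at most $e$ malicious servers, whenever a read returns, the tag $t$ that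 it selected is either $t_0$ (then put $m:=m_0$) or the tag of a write, of some vector $m$, that reached its finalize phase before; the read has received at least $k+2e$ shares of tag $t$, at most $e$ of them different from the corresponding share of $m$; the Berlekamp--Welch decoder applied to these shares outputs $m$; and the read returns the secret of $m$. -/

import Mathlib

namespace CAS

open Polynomial

/-! ### Reed–Solomon codes and Berlekamp–Welch decoding -/

section Coding

variable {N : ℕ} {K : Type*} [Field K]

/-- The `(N,k)` Reed–Solomon code with evaluation points `α`: the message
`m = (σ₁, …, σ_k)` is read as the polynomial `σ₁ + σ₂ X + ⋯ + σ_k X^(k-1)` and the `i`-th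
coded element (share) is its value at `α i`. -/
def encode (α : Fin N → K) {k : ℕ} (m : Fin k → K) (i : Fin N) : K :=
  ∑ j : Fin k, m j * α i ^ (j : ℕ)

/-- The secret carried by a message vector is its first coordinate; the others are padding
(randomly chosen by the writer). -/
def secret {k : ℕ} [NeZero k] (m : Fin k → K) : K := m 0

/-- The key equations of the Berlekamp–Welch algorithm for received values `y`
(`none` marks an erasure) and at most `e` errors: a non-zero error locator `E` of degree at
most `e` and a polynomial `Q` of degree less than `k + e` such that `Q(αᵢ) = yᵢ E(αᵢ)` for
every received `yᵢ`. -/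
def IsKeySolution (α : Fin N → K) (k e : ℕ) (y : Fin N → Option K) (EQ : K[X] × K[X]) : Prop :=
  EQ.1 ≠ 0 ∧ EQ.1.natDegree ≤ e ∧ EQ.2.degree < ((k + e : ℕ) : WithBot ℕ) ∧
    ∀ i w, y i = some w → EQ.2.eval (α i) = w * EQ.1.eval (α i)

open Classical in
/-- The Berlekamp–Welch decoder: take some solution `(E, Q)` of the key equations and, if `E`
divides `Q`, output the coefficients of `Q / E`; otherwise report a failure. -/
noncomputable def berlekampWelch (α : Fin N → K) (k e : ℕ) (y : Fin N → Option K) :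
    Option (Fin k → K) :=
  if h : ∃ EQ, IsKeySolution α k e y EQ then
    if h.choose.1 ∣ h.choose.2 then some fun j => (h.choose.2 / h.choose.1).coeff (j : ℕ)
    else none
  else none

open Classical in
/-- The number of received values. -/
noncomputable def numReceived (y : Fin N → Option K) : ℕ :=
  (Finset.univ.filter fun i => y i ≠ none).card

open Classical in
/-- The number of received values that differ from the coded elements of `m`. -/
noncomputable def numCorrupted (α : Fin N → K) {k : ℕ} (m : Fin k → K) (y : Fin N → Option K) : ℕ :=
  (Finset.univ.filter fun i => y i ≠ none ∧ y i ≠ some (encode α m i)).card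

end Coding

/-! ### Tags, records and messages -/

/-- Tags: pairs of a positive integer and a client identifier in lexicographic order, together
with the default tag `t₀ = ⊥` below all of them. -/
abbrev Tag (C : Type*) := WithBot (ℕ+ ×ₗ C)

/-- The integer part of a tag (`0` for the default tag). -/
def Tag.num {C : Type*} (t : Tag C) : ℕ :=
  WithBot.recBotCoe (C := fun _ => ℕ) 0 (fun x => ((ofLex x).1 : ℕ)) t

/-- The tag `(z + 1, c)`, where `z` is the integer part of `t`. -/
def Tag.next {C : Type*} (t : Tag C) (c : C) : Tag C :=
  ((toLex (Nat.succPNat (Tag.num t), c) : ℕ+ ×ₗ C) : Tag C)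

/-- The labels of records and messages (the records of a server only use `pre` and `fin`). -/
inductive Label where
  | qry
  | pre
  | fin

/-- A triple `(t, w, d)` of a tag, a coded element or `⊥` (`none`), and a label. It serves as a
record in the storage of a server and as the content of a reply to a client. -/
structure Rec (K C : Type*) where
  tag : Tag C
  data : Option K
  label : Label

/-- The requests of clients: a query, the pre-write of a coded element, a finalize request of a
writer and a finalize request of a reader. -/
inductive Request (K C : Type*) where
  | qry
  | pre (t : Tag C) (w : K)
  | finW (t : Tag C)
  | finR (t : Tag C)

/-- Messages. A request carries the running number of the quorum access to which it belongs;
the reply repeats that number, so that a client can tell replies to its current access from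
late ones. -/
inductive Msg (N : ℕ) (K C : Type*) where
  | request (c : C) (i : Fin N) (seq : ℕ) (r : Request K C)
  | reply (i : Fin N) (c : C) (seq : ℕ) (r : Rec K C)
  | gossip (i j : Fin N) (t : Tag C)

/-- Servers and clients. -/
abbrev Proc (N : ℕ) (C : Type*) := Fin N ⊕ C

/-- The sender of a message. -/
def Msg.src {N : ℕ} {K C : Type*} : Msg N K C → Proc N C
  | .request c _ _ _ => .inr c
  | .reply i _ _ _ => .inl i
  | .gossip i _ _ => .inl i

/-- The receiver of a message. -/
def Msg.dst {N : ℕ} {K C : Type*} : Msg N K C → Proc N C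
  | .request _ i _ _ => .inl i
  | .reply _ c _ _ => .inr c
  | .gossip _ j _ => .inl j

/-! ### The server -/

section Server

variable {N : ℕ} {K C : Type*} [LinearOrder C]

open Classical in
/-- The highest tag of a record labelled `fin` (the default tag if there is none). -/
noncomputable def maxFin (S : Finset (Rec K C)) : Tag C :=
  (S.filter fun r => r.label = Label.fin).sup Rec.tag

open Classical in
/-- Relabel every record with tag `t` as `fin`. -/
noncomputable def relabel (S : Finset (Rec K C)) (t : Tag C) : Finset (Rec K C) :=
  S.image fun r => if r.tag = t then { r with label := Label.fin } else r

open Classical in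
/-- The coded element with tag `t` in the storage, if there is one. -/
noncomputable def storedShare (S : Finset (Rec K C)) (t : Tag C) : Option K :=
  if h : ∃ w : K, ∃ d, Rec.mk t (some w) d ∈ S then some h.choose else none

open Classical in
/-- The new storage of a server after a request. -/
noncomputable def storageAfter (S : Finset (Rec K C)) : Request K C → Finset (Rec K C)
  | .qry => S
  | .pre t w => if ∃ r ∈ S, r.tag = t then S else insert ⟨t, some w, .pre⟩ S
  | .finW t =>
      if ∃ w, Rec.mk t w .pre ∈ S then relabel S t else insert ⟨t, none, .fin⟩ S
  | .finR t =>
      if ∃ w : K, ∃ d, Rec.mk t (some w) d ∈ S then relabel S t else insert ⟨t, none, .fin⟩ S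

/-- The reply of a correct server with storage `S` to a request. -/
noncomputable def correctReply (S : Finset (Rec K C)) : Request K C → Rec K C
  | .qry => ⟨maxFin S, none, .qry⟩
  | .pre t w => ⟨t, some w, .pre⟩
  | .finW t => ⟨t, none, .fin⟩
  | .finR t => ⟨t, storedShare S t, .fin⟩

/-- What a malicious server may send in place of the correct reply `r`: tag and label are
unchanged, and a coded element may be replaced by any field element. (It may also make up a
coded element where there is none; it does not withhold one.) -/
def Corruption (r r' : Rec K C) : Prop :=
  r'.tag = r.tag ∧ r'.label = r.label ∧ (r.data ≠ none → r'.data ≠ none)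

/-- The gossip messages of server `i` after a request. -/
def gossipAfter (i : Fin N) : Request K C → Multiset (Msg N K C)
  | .qry => 0
  | .pre _ _ => 0
  | .finW t => (Finset.univ.erase i).val.map fun j => .gossip i j t
  | .finR t => (Finset.univ.erase i).val.map fun j => .gossip i j t

open Classical in
/-- The new storage of a server after the arrival of the gossip message `t`. -/
noncomputable def storageAfterGossip (S : Finset (Rec K C)) (t : Tag C) : Finset (Rec K C) :=
  if ∃ r ∈ S, r.tag = t then relabel S t else insert ⟨t, none, .fin⟩ S

end Server

/-! ### The client -/

/-- Where a client is in its procedure: not in an operation; in the query, pre-write or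
finalize phase of a write; in the query or finalize phase of a read. -/
inductive Phase (k : ℕ) (K C : Type*) where
  | idle
  | wQry (m : Fin k → K)
  | wPre (m : Fin k → K) (t : Tag C)
  | wFin (m : Fin k → K) (t : Tag C)
  | rQry
  | rFin (t : Tag C)

/-- The state of a client: its phase, the number of its latest quorum access, and the replies to
that access that have arrived so far. -/
structure Client (N k : ℕ) (K C : Type*) where
  phase : Phase k K C
  seq : ℕ
  replies : Fin N → Option (Rec K C)

/-- The size `⌈(N + k + 2e) / 2⌉` from which on a set of servers is a quorum. -/
def quorumSize (N k e : ℕ) : ℕ := ⌈((N + k + 2 * e : ℕ) : ℚ) / 2⌉₊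

section Client

variable {N k : ℕ} {K C : Type*}

open Classical in
/-- A quorum of servers has replied to the current access. -/
def Client.HasQuorum (e : ℕ) (cl : Client N k K C) : Prop :=
  quorumSize N k e ≤ (Finset.univ.filter fun i => cl.replies i ≠ none).card

/-- The maximal tag in the replies. -/
def Client.maxTag [LinearOrder C] (cl : Client N k K C) : Tag C :=
  Finset.univ.sup fun i => (cl.replies i).elim ⊥ Rec.tag

open Classical in
/-- The coded elements with tag `t` and label `fin` in the replies, by server. -/
noncomputable def Client.shares (cl : Client N k K C) (t : Tag C) (i : Fin N) : Option K :=
  (cl.replies i).bind fun r => if r.tag = t ∧ r.label = Label.fin then r.data else none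

/-- The result of a read of tag `t`: if at least `k + 2e` replies hold a coded element, the
secret in the output of the decoder; otherwise `⊥`. -/
noncomputable def Client.readResult [Field K] [NeZero k] (α : Fin N → K) (e : ℕ)
    (cl : Client N k K C) (t : Tag C) : Option K :=
  if k + 2 * e ≤ numReceived (cl.shares t) then
    (berlekampWelch α k e (cl.shares t)).map secret
  else none

end Client

/-! ### The system -/

/-- A state of the system: storages, clients, messages in transit, crashed processes. -/
structure State (N k : ℕ) (K C : Type*) where
  storage : Fin N → Finset (Rec K C)
  client : C → Client N k K C
  net : Multiset (Msg N K C)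
  crashed : Set (Proc N C)

/-- The atomic actions: nothing; the invocation of a write (of a message vector whose first
coordinate is the value written) or of a read; the delivery of a message; the passage of a
client to its next phase; the return of a write or of a read; a crash. -/
inductive Action (N k : ℕ) (K C : Type*) where
  | idle
  | invWrite (c : C) (m : Fin k → K)
  | invRead (c : C)
  | deliver (msg : Msg N K C)
  | advance (c : C)
  | retWrite (c : C)
  | retRead (c : C) (v : Option K)
  | crash (p : Proc N C)

section System

variable {N k : ℕ} {K C : Type*} [Field K] [LinearOrder C]

/-- The initial state for the initial message vector `m₀`. -/
def initState (α : Fin N → K) (m₀ : Fin k → K) : State N k K C where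
  storage i := {⟨⊥, some (encode α m₀ i), .fin⟩}
  client _ := ⟨.idle, 0, fun _ => none⟩
  net := 0
  crashed := ∅

/-- Client `c` enters phase `ph` and starts a quorum access by sending `req i` to every
server `i`. -/
def State.access (s : State N k K C) (c : C) (ph : Phase k K C) (req : Fin N → Request K C) :
    State N k K C :=
  { s with
    client := Function.update s.client c ⟨ph, (s.client c).seq + 1, fun _ => none⟩
    net := s.net +
      Finset.univ.val.map fun i => Msg.request c i ((s.client c).seq + 1) (req i) }

/-- Client `c` ends its operation. -/
def State.finish (s : State N k K C) (c : C) : State N k K C :=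
  { s with client := Function.update s.client c ⟨.idle, (s.client c).seq, fun _ => none⟩ }

/-- Client `c` receives reply `r` of server `i` to access number `q`; it ignores replies to
earlier accesses. -/
def State.receive (s : State N k K C) (i : Fin N) (c : C) (q : ℕ) (r : Rec K C) : State N k K C :=
  { s with
    client := Function.update s.client c
      (if q = (s.client c).seq then
        { s.client c with replies := Function.update (s.client c).replies i (some r) }
      else s.client c) }

/-- The steps of the algorithm with `(k + 2e)`-overlap quorums when the servers in `M` are
malicious. -/
inductive Step [NeZero k] (α : Fin N → K) (e : ℕ) (M : Finset (Fin N)) :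
    State N k K C → Action N k K C → State N k K C → Prop
  | idle (s) : Step α e M s .idle s
  | crash (s p) : Step α e M s (.crash p) { s with crashed := insert p s.crashed }
  | invWrite (s c m) (hc : .inr c ∉ s.crashed) (hp : (s.client c).phase = .idle) :
      Step α e M s (.invWrite c m) (s.access c (.wQry m) fun _ => .qry)
  | invRead (s c) (hc : .inr c ∉ s.crashed) (hp : (s.client c).phase = .idle) :
      Step α e M s (.invRead c) (s.access c .rQry fun _ => .qry)
  | preWrite (s c m) (hc : .inr c ∉ s.crashed) (hp : (s.client c).phase = .wQry m)
      (hq : (s.client c).HasQuorum e) :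
      Step α e M s (.advance c)
        (s.access c (.wPre m ((s.client c).maxTag.next c))
          fun i => .pre ((s.client c).maxTag.next c) (encode α m i))
  | finalizeWrite (s c m t) (hc : .inr c ∉ s.crashed) (hp : (s.client c).phase = .wPre m t)
      (hq : (s.client c).HasQuorum e) :
      Step α e M s (.advance c) (s.access c (.wFin m t) fun _ => .finW t)
  | retWrite (s c m t) (hc : .inr c ∉ s.crashed) (hp : (s.client c).phase = .wFin m t)
      (hq : (s.client c).HasQuorum e) :
      Step α e M s (.retWrite c) (s.finish c)
  | finalizeRead (s c) (hc : .inr c ∉ s.crashed) (hp : (s.client c).phase = .rQry)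
      (hq : (s.client c).HasQuorum e) :
      Step α e M s (.advance c)
        (s.access c (.rFin (s.client c).maxTag) fun _ => .finR (s.client c).maxTag)
  | retRead (s c t) (hc : .inr c ∉ s.crashed) (hp : (s.client c).phase = .rFin t)
      (hq : (s.client c).HasQuorum e) :
      Step α e M s (.retRead c ((s.client c).readResult α e t)) (s.finish c)
  | request (s c i q req rest r) (hi : .inl i ∉ s.crashed)
      (hnet : s.net = Msg.request c i q req ::ₘ rest)
      (hr : r = correctReply (s.storage i) req ∨
        i ∈ M ∧ Corruption (correctReply (s.storage i) req) r) :
      Step α e M s (.deliver (.request c i q req))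
        { s with
          storage := Function.update s.storage i (storageAfter (s.storage i) req)
          net := rest + (Msg.reply i c q r ::ₘ gossipAfter i req) }
  | gossip (s i j t rest) (hj : .inl j ∉ s.crashed) (hnet : s.net = Msg.gossip i j t ::ₘ rest) :
      Step α e M s (.deliver (.gossip i j t))
        { s with
          storage := Function.update s.storage j (storageAfterGossip (s.storage j) t)
          net := rest }
  | reply (s i c q r rest) (hc : .inr c ∉ s.crashed) (hnet : s.net = Msg.reply i c q r ::ₘ rest) :
      Step α e M s (.deliver (.reply i c q r)) { s.receive i c q r with net := rest }

variable (C) in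
/-- An execution with malicious servers `M` from the initial message vector `m₀`. (A finite
execution is continued by idle actions.) -/
structure Execution [NeZero k] (α : Fin N → K) (e : ℕ) (m₀ : Fin k → K) (M : Finset (Fin N)) where
  state : ℕ → State N k K C
  act : ℕ → Action N k K C
  init : state 0 = initState α m₀
  step : ∀ n, Step α e M (state n) (act n) (state (n + 1))

end System

/-! ### The task: an atomic register whose operations terminate -/

/-- The action is the invocation of an operation by client `c`. -/
def Action.IsInv {N k : ℕ} {K C : Type*} (a : Action N k K C) (c : C) : Prop :=
  a = .invRead c ∨ ∃ m, a = .invWrite c m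

/-- The action is the return of an operation of client `c`. -/
def Action.IsRet {N k : ℕ} {K C : Type*} (a : Action N k K C) (c : C) : Prop :=
  a = .retWrite c ∨ ∃ v, a = .retRead c v

/-- The value of the register after action `a` took effect on the value `v`. -/
def Action.apply {N k : ℕ} [NeZero k] {K C : Type*} (v : K) : Action N k K C → K
  | .invWrite _ m => m 0
  | _ => v

section Task

variable {N k : ℕ} [NeZero k] {K C : Type*} [Field K] [LinearOrder C]
  {α : Fin N → K} {e : ℕ} {m₀ : Fin k → K} {M : Finset (Fin N)}

/-- The processes that crash at some time. -/
def Execution.faulty (E : Execution C α e m₀ M) : Set (Proc N C) :=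
  {p | ∃ n, p ∈ (E.state n).crashed}

/-- At most `f` servers crash (clients may crash without a bound). -/
def Execution.CrashesAtMost (E : Execution C α e m₀ M) (f : ℕ) : Prop :=
  {i : Fin N | Sum.inl i ∈ E.faulty}.ncard ≤ f

/-- Fairness: a message between processes that never crash is eventually delivered, and a client
that never crashes and has heard from a quorum eventually continues. -/
structure Execution.Fair (E : Execution C α e m₀ M) : Prop where
  deliver : ∀ n msg, msg ∈ (E.state n).net → msg.src ∉ E.faulty → msg.dst ∉ E.faulty →
    ∃ n' ≥ n, E.act n' = .deliver msg
  progress : ∀ n c, .inr c ∉ E.faulty → ((E.state n).client c).phase ≠ .idle →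
    ((E.state n).client c).HasQuorum e →
    ∃ n' ≥ n, E.act n' = .advance c ∨ (E.act n').IsRet c

/-- The operation invoked at time `n` returns at time `n'`. (Operations are identified by the
time of their invocation; each client invokes its operations one after the other.) -/
def Execution.Returns (E : Execution C α e m₀ M) (n n' : ℕ) : Prop :=
  ∃ c, (E.act n).IsInv c ∧ n < n' ∧ (E.act n').IsRet c ∧
    ∀ j, n < j → j < n' → ¬ (E.act j).IsRet c

/-- The actions before time `T` form a linearizable history of a read/write register with
initial value `m₀ 0`: there is a sequence `L` of operations, with all those that have returned
and possibly some pending ones, in which an operation that returned before another one was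
invoked does not come after it, and in which each returned read has returned the value of the
last write before it (the initial value if there is none). -/
def Execution.LinearizableUpTo (E : Execution C α e m₀ M) (T : ℕ) : Prop :=
  ∃ L : List ℕ, L.Nodup ∧
    (∀ n ∈ L, n < T ∧ ∃ c, (E.act n).IsInv c) ∧
    (∀ n n', n' < T → E.Returns n n' → n ∈ L) ∧
    L.Pairwise (fun a b => ¬ ∃ b', E.Returns b b' ∧ b' < a) ∧
    ∀ L₁ n L₂, L = L₁ ++ n :: L₂ → ∀ n' c v, n' < T → E.Returns n n' →
      E.act n' = .retRead c v →
      v = some (L₁.foldl (fun x j => (E.act j).apply x) (m₀ 0))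

/-- Every operation of a client that never crashes returns. -/
def Execution.Live (E : Execution C α e m₀ M) : Prop :=
  ∀ n c, (E.act n).IsInv c → .inr c ∉ E.faulty → ∃ n', E.Returns n n'

/-- Before time `n`, tag `t` was the tag of a write of the message vector `m` that had reached
its finalize phase; or `t` is the default tag and `m` the initial message vector. -/
def Execution.Finalized (E : Execution C α e m₀ M) (n : ℕ) (t : Tag C) (m : Fin k → K) : Prop :=
  (t = ⊥ ∧ m = m₀) ∨ ∃ n' < n, ∃ c, ((E.state n').client c).phase = .wFin m t

end Task

/-- The algorithm (with parameters `α`, `k`, `e` and initial message vector `m₀`) is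
`(s,t)`-robust: whenever at most `s` servers crash and at most `t` servers are malicious, it
implements an atomic register, and in fair executions every operation of a correct client
terminates. -/
def Robust {N k : ℕ} [NeZero k] {K : Type*} (C : Type*) [Field K] [LinearOrder C]
    (α : Fin N → K) (e : ℕ) (m₀ : Fin k → K) (s t : ℕ) : Prop :=
  ∀ (M : Finset (Fin N)) (E : Execution C α e m₀ M), M.card ≤ t → E.CrashesAtMost s →
    (∀ T, E.LinearizableUpTo T) ∧ (E.Fair → E.Live)

end CAS

/-!
Two quorums have at least `k + 2e` servers in common. So a query that starts after some operation
has returned hears of the tag of that operation, and hence tags respect the real-time order of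
operations; ordering the operations by tag, and for equal tags writes before reads, is a
linearization.

A server can hold the placeholder `⊥` for a tag only after the tag has been finalized, and the
writer finalizes it only after a quorum has acknowledged the shares, so that quorum has stored them.
The quorum that answers the finalize request of a reader meets it in at least `k + 2e` servers, of
which at most `e` are malicious. For every solution `(P, Q)` of the key equations, `Q - F * P`,
where `F` is the message polynomial, has degree less than `k + e` and vanishes at the evaluation
points of the at least `k + e` uncorrupted shares. Hence `Q = F * P`, and the decoder returns the
message.
-/

namespace CAS

open Polynomial

/-! ### The Berlekamp–Welch decoder -/

section Decoder

variable {N k : ℕ} {K : Type*} [Field K]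

/-- The polynomial `σ₁ + σ₂ X + ⋯ + σ_k X^(k-1)` of a message vector, whose values are the coded
elements. -/
noncomputable def messagePoly (m : Fin k → K) : K[X] :=
  (degreeLTEquiv K k).symm m

theorem degree_messagePoly_lt (m : Fin k → K) : (messagePoly m).degree < (k : WithBot ℕ) :=
  mem_degreeLT.1 (Subtype.property _)

theorem coeff_messagePoly (m : Fin k → K) (j : Fin k) : (messagePoly m).coeff j = m j :=
  congrFun ((degreeLTEquiv K k).apply_symm_apply m) j

theorem eval_messagePoly (α : Fin N → K) (m : Fin k → K) (i : Fin N) :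
    (messagePoly m).eval (α i) = encode α m i :=
  (eval_eq_sum_degreeLTEquiv (Subtype.property _) _).trans <| by
    simp only [Subtype.coe_eta, LinearEquiv.apply_symm_apply, encode]

theorem degree_messagePoly_mul_lt (m : Fin k → K) {E : K[X]} {e : ℕ} (hE₀ : E ≠ 0)
    (hE : E.natDegree ≤ e) : (messagePoly m * E).degree < ((k + e : ℕ) : WithBot ℕ) := by
  rw [degree_mul, Nat.cast_add]
  exact WithBot.add_lt_add_of_lt_of_le (degree_ne_bot.2 hE₀) (degree_messagePoly_lt m)
    (natDegree_le_iff_degree_le.1 hE)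

open Classical in
theorem exists_isKeySolution (α : Fin N → K) {e : ℕ} {m : Fin k → K} {y : Fin N → Option K}
    (hc : numCorrupted α m y ≤ e) : ∃ EQ, IsKeySolution α k e y EQ := by
  let B := Finset.univ.filter fun i => y i ≠ none ∧ y i ≠ some (encode α m i)
  -- The error locator: it vanishes at the evaluation points of the corrupted positions.
  let E : K[X] := Lagrange.nodal B α
  have hE₀ : E ≠ 0 := Lagrange.nodal_ne_zero
  have hE : E.natDegree ≤ e := Lagrange.natDegree_nodal.trans_le hc
  refine ⟨(E, messagePoly m * E), hE₀, hE, degree_messagePoly_mul_lt m hE₀ hE, fun i w hw => ?_⟩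
  rw [eval_mul, eval_messagePoly]
  by_cases hi : i ∈ B
  · simp only [E, Lagrange.eval_nodal_at_node hi, mul_zero]
  · have hy : y i = some (encode α m i) := by simpa [B, hw] using hi
    rw [Option.some.inj (hw.symm.trans hy)]

open Classical in
theorem IsKeySolution.eq_messagePoly_mul {α : Fin N → K} (hα : Function.Injective α) {e : ℕ}
    {m : Fin k → K} {y : Fin N → Option K} {EQ : K[X] × K[X]} (h : IsKeySolution α k e y EQ)
    (hr : k + 2 * e ≤ numReceived y) (hc : numCorrupted α m y ≤ e) :
    EQ.2 = messagePoly m * EQ.1 := by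
  obtain ⟨hE₀, hE, hQ, hkey⟩ := h
  let R := Finset.univ.filter fun i => y i ≠ none
  let B := Finset.univ.filter fun i => y i ≠ none ∧ y i ≠ some (encode α m i)
  have hcard : k + e ≤ (R \ B).card := by
    have hsdiff : R.card - B.card ≤ (R \ B).card := Finset.le_card_sdiff _ _
    have hR : k + 2 * e ≤ R.card := hr
    have hB : B.card ≤ e := hc
    omega
  refine sub_eq_zero.1 <|
    eq_zero_of_degree_lt_of_eval_index_eq_zero _ (hα.injOn (s := ↑(R \ B))) ?_ fun i hi => ?_
  · calc (EQ.2 - messagePoly m * EQ.1).degree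
        ≤ max EQ.2.degree (messagePoly m * EQ.1).degree := degree_sub_le _ _
      _ < ((k + e : ℕ) : WithBot ℕ) := max_lt hQ (degree_messagePoly_mul_lt m hE₀ hE)
      _ ≤ ((R \ B).card : WithBot ℕ) := Nat.cast_le.2 hcard
  · have hy : y i = some (encode α m i) := by
      simp only [R, B, Finset.mem_sdiff, Finset.mem_filter, Finset.mem_univ, true_and] at hi
      tauto
    rw [eval_sub, eval_mul, eval_messagePoly, hkey i _ hy, sub_self]

theorem berlekampWelch_eq_some {α : Fin N → K} (hα : Function.Injective α) {e : ℕ}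
    {m : Fin k → K} {y : Fin N → Option K} (hr : k + 2 * e ≤ numReceived y)
    (hc : numCorrupted α m y ≤ e) : berlekampWelch α k e y = some m := by
  have hex : ∃ EQ, IsKeySolution α k e y EQ := exists_isKeySolution α hc
  have hmul := hex.choose_spec.eq_messagePoly_mul hα hr hc
  have hdiv : hex.choose.2 / hex.choose.1 = messagePoly m := by
    rw [hmul, mul_div_cancel_right₀ _ hex.choose_spec.1]
  rw [berlekampWelch, dif_pos hex, if_pos (hmul ▸ dvd_mul_left _ _), hdiv]
  exact congrArg some (funext (coeff_messagePoly m))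

end Decoder

/-! ### Quorums -/

section Quorums

theorem quorumSize_le_iff {N k e n : ℕ} : quorumSize N k e ≤ n ↔ N + k + 2 * e ≤ 2 * n := by
  rw [quorumSize, Nat.ceil_le, div_le_iff₀ two_pos, mul_comm 2 n]
  exact_mod_cast Iff.rfl

variable {N k e : ℕ}

theorem le_card_inter_of_quorumSize_le {A B : Finset (Fin N)} (hA : quorumSize N k e ≤ A.card)
    (hB : quorumSize N k e ≤ B.card) : k + 2 * e ≤ (A ∩ B).card := by
  rw [quorumSize_le_iff] at hA hB
  have hsum := Finset.card_union_add_card_inter A B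
  have hunion : (A ∪ B).card ≤ N := card_finset_fin_le _
  omega

theorem Client.HasQuorum.exists_finset {K C : Type*} {cl : Client N k K C} (h : cl.HasQuorum e) :
    ∃ Q : Finset (Fin N), quorumSize N k e ≤ Q.card ∧ ∀ i ∈ Q, ∃ r, cl.replies i = some r := by
  classical
  exact ⟨_, h, fun i hi => Option.ne_none_iff_exists'.1 (Finset.mem_filter.1 hi).2⟩

end Quorums

/-! ### Storages -/

section Storage

variable {N : ℕ} {K C : Type*}

/-- The storage holds a record of tag `t` labelled `fin`. -/
def HasFin (S : Finset (Rec K C)) (t : Tag C) : Prop := ∃ w, Rec.mk t w .fin ∈ S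

/-- The storage holds a coded element of tag `t`. -/
def HasShare (S : Finset (Rec K C)) (t : Tag C) : Prop := ∃ w : K, ∃ d, Rec.mk t (some w) d ∈ S

theorem exists_mem_of_storedShare_eq_some {S : Finset (Rec K C)} {t : Tag C} {w : K}
    (h : storedShare S t = some w) : ∃ d, Rec.mk t (some w) d ∈ S := by
  rw [storedShare] at h
  split_ifs at h with hS
  exact Option.some.inj h ▸ hS.choose_spec

theorem HasShare.storedShare_ne_none {S : Finset (Rec K C)} {t : Tag C} (h : HasShare S t) :
    storedShare S t ≠ none := by
  have hS : ∃ w : K, ∃ d, Rec.mk t (some w) d ∈ S := h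
  simp [storedShare, hS]

/-- A finalize request for tag `t`, of a writer or of a reader. -/
def Request.Finalizes (req : Request K C) (t : Tag C) : Prop := req = .finW t ∨ req = .finR t

variable [LinearOrder C]

theorem mem_relabel {S : Finset (Rec K C)} {t : Tag C} {r : Rec K C} :
    r ∈ relabel S t ↔
      r ∈ S ∧ r.tag ≠ t ∨ r.tag = t ∧ r.label = .fin ∧ ∃ d, Rec.mk t r.data d ∈ S := by
  classical
  obtain ⟨t', w, d⟩ := r
  simp only [relabel, Finset.mem_image]
  constructor
  · rintro ⟨⟨t₁, w₁, d₁⟩, h₁, heq⟩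
    split_ifs at heq with ht
    · obtain ⟨rfl, rfl, rfl⟩ := (Rec.mk.injEq ..).mp heq
      exact Or.inr ⟨ht, rfl, d₁, by subst ht; exact h₁⟩
    · obtain ⟨rfl, rfl, rfl⟩ := (Rec.mk.injEq ..).mp heq
      exact Or.inl ⟨h₁, ht⟩
  · rintro (⟨h₁, ht⟩ | ⟨rfl, rfl, d', h₁⟩)
    · exact ⟨_, h₁, if_neg ht⟩
    · exact ⟨_, h₁, if_pos rfl⟩

open Classical in
/-- The ways in which the storage `S` of a server may change when a message arrives; the tags
that the message finalizes satisfy `fin`, and the coded elements that it brings satisfy `pre`. -/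
inductive StorageStep (fin : Tag C → Prop) (pre : Tag C → K → Prop) (S : Finset (Rec K C)) :
    Finset (Rec K C) → Prop
  | refl : StorageStep fin pre S S
  | relabel (t) (ht : fin t) : StorageStep fin pre S (relabel S t)
  | placeholder (t) (ht : fin t) : StorageStep fin pre S (insert ⟨t, none, .fin⟩ S)
  | preWrite (t w) (hw : pre t w) : StorageStep fin pre S (insert ⟨t, some w, .pre⟩ S)

namespace StorageStep

variable {fin fin' : Tag C → Prop} {pre pre' : Tag C → K → Prop} {S S' : Finset (Rec K C)}
  {t : Tag C}

theorem mono (h : StorageStep fin pre S S') (hfin : ∀ t, fin t → fin' t)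
    (hpre : ∀ t w, pre t w → pre' t w) : StorageStep fin' pre' S S' := by
  cases h with
  | refl => exact .refl
  | relabel t ht => exact .relabel t (hfin t ht)
  | placeholder t ht => exact .placeholder t (hfin t ht)
  | preWrite t w hw => exact .preWrite t w (hpre t w hw)

theorem hasFin_mono (h : StorageStep fin pre S S') (ht : HasFin S t) : HasFin S' t := by
  classical
  obtain ⟨w, hw⟩ := ht
  cases h with
  | refl => exact ⟨w, hw⟩
  | relabel u =>
    rcases eq_or_ne t u with rfl | htu
    · exact ⟨w, mem_relabel.2 (Or.inr ⟨rfl, rfl, _, hw⟩)⟩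
    · exact ⟨w, mem_relabel.2 (Or.inl ⟨hw, htu⟩)⟩
  | placeholder | preWrite => exact ⟨w, Finset.mem_insert_of_mem hw⟩

theorem hasShare_mono (h : StorageStep fin pre S S') (ht : HasShare S t) : HasShare S' t := by
  classical
  obtain ⟨w, d, hw⟩ := ht
  cases h with
  | refl => exact ⟨w, d, hw⟩
  | relabel u =>
    rcases eq_or_ne t u with rfl | htu
    · exact ⟨w, _, mem_relabel.2 (Or.inr ⟨rfl, rfl, _, hw⟩)⟩
    · exact ⟨w, d, mem_relabel.2 (Or.inl ⟨hw, htu⟩)⟩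
  | placeholder | preWrite => exact ⟨w, d, Finset.mem_insert_of_mem hw⟩

theorem hasFin_or_fin (h : StorageStep fin pre S S') (ht : HasFin S' t) : HasFin S t ∨ fin t := by
  classical
  obtain ⟨w, hw⟩ := ht
  cases h with
  | refl => exact Or.inl ⟨w, hw⟩
  | relabel u hu =>
    rcases mem_relabel.1 hw with ⟨hw, -⟩ | ⟨rfl, -⟩
    · exact Or.inl ⟨w, hw⟩
    · exact Or.inr hu
  | placeholder u hu =>
    rcases Finset.mem_insert.1 hw with heq | hw
    · cases heq
      exact Or.inr hu
    · exact Or.inl ⟨w, hw⟩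
  | preWrite u w' =>
    rcases Finset.mem_insert.1 hw with heq | hw
    · cases heq
    · exact Or.inl ⟨w, hw⟩

theorem exists_mem_or_pre (h : StorageStep fin pre S S') {w : K} {d : Label}
    (hw : Rec.mk t (some w) d ∈ S') : (∃ d', Rec.mk t (some w) d' ∈ S) ∨ pre t w := by
  classical
  cases h with
  | refl => exact Or.inl ⟨d, hw⟩
  | relabel u =>
    rcases mem_relabel.1 hw with ⟨hw, -⟩ | ⟨rfl, -, hw⟩
    · exact Or.inl ⟨d, hw⟩
    · exact Or.inl hw
  | placeholder u =>
    rcases Finset.mem_insert.1 hw with heq | hw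
    · cases heq
    · exact Or.inl ⟨d, hw⟩
  | preWrite u w' hw' =>
    rcases Finset.mem_insert.1 hw with heq | hw
    · cases heq
      exact Or.inr hw'
    · exact Or.inl ⟨d, hw⟩

theorem label_eq_fin_of_data_eq_none (h : StorageStep fin pre S S')
    (hS : ∀ t d, Rec.mk t none d ∈ S → d = .fin) {d : Label} (hd : Rec.mk t none d ∈ S') :
    d = .fin := by
  classical
  cases h with
  | refl => exact hS t d hd
  | relabel u =>
    rcases mem_relabel.1 hd with ⟨hd, -⟩ | ⟨-, hd, -⟩
    · exact hS t d hd
    · exact hd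
  | placeholder u =>
    rcases Finset.mem_insert.1 hd with heq | hd
    · cases heq
      rfl
    · exact hS t d hd
  | preWrite u w =>
    rcases Finset.mem_insert.1 hd with heq | hd
    · cases heq
    · exact hS t d hd

end StorageStep

variable {S : Finset (Rec K C)} {t : Tag C} {req : Request K C}

theorem storageStep_storageAfter (S : Finset (Rec K C)) (req : Request K C) :
    StorageStep req.Finalizes (fun t w => req = .pre t w) S (storageAfter S req) := by
  cases req with
  | qry => exact .refl
  | pre t w =>
    rw [storageAfter]
    split_ifs
    exacts [.refl, .preWrite t w rfl]
  | finW t =>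
    rw [storageAfter]
    split_ifs
    exacts [.relabel t (Or.inl rfl), .placeholder t (Or.inl rfl)]
  | finR t =>
    rw [storageAfter]
    split_ifs
    exacts [.relabel t (Or.inr rfl), .placeholder t (Or.inr rfl)]

theorem storageStep_storageAfterGossip (S : Finset (Rec K C)) (t : Tag C) :
    StorageStep (· = t) (fun _ _ => False) S (storageAfterGossip S t) := by
  rw [storageAfterGossip]
  split_ifs
  exacts [.relabel t rfl, .placeholder t rfl]

theorem hasFin_relabel {w : Option K} {d : Label} (h : Rec.mk t w d ∈ S) :
    HasFin (relabel S t) t :=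
  ⟨w, mem_relabel.2 (Or.inr ⟨rfl, rfl, d, h⟩)⟩

theorem hasFin_storageAfter (S : Finset (Rec K C)) (h : req.Finalizes t) :
    HasFin (storageAfter S req) t := by
  classical
  rcases h with rfl | rfl <;> rw [storageAfter] <;> split_ifs with h
  · exact hasFin_relabel h.choose_spec
  · exact ⟨none, Finset.mem_insert_self _ _⟩
  · exact hasFin_relabel h.choose_spec.choose_spec
  · exact ⟨none, Finset.mem_insert_self _ _⟩

theorem hasShare_storageAfter_pre (h : ∀ d, Rec.mk t none d ∉ S) (w : K) :
    HasShare (storageAfter S (.pre t w)) t := by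
  classical
  rw [storageAfter]
  split_ifs with hr
  · obtain ⟨⟨_, _ | w', d⟩, hr, rfl⟩ := hr
    · exact absurd hr (h d)
    · exact ⟨w', d, hr⟩
  · exact ⟨w, .pre, Finset.mem_insert_self _ _⟩

theorem HasFin.le_maxFin (h : HasFin S t) : t ≤ maxFin S := by
  classical
  obtain ⟨w, hw⟩ := h
  exact Finset.le_sup (f := Rec.tag) (b := ⟨t, w, .fin⟩) (Finset.mem_filter.2 ⟨hw, rfl⟩)

theorem maxFin_eq_bot_or_hasFin (S : Finset (Rec K C)) : maxFin S = ⊥ ∨ HasFin S (maxFin S) := by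
  classical
  rcases (S.filter fun r => r.label = Label.fin).eq_empty_or_nonempty with h | h
  · exact Or.inl (by rw [maxFin, h, Finset.sup_empty])
  · obtain ⟨⟨t, w, d⟩, hr, hsup⟩ := Finset.exists_mem_eq_sup _ h Rec.tag
    obtain ⟨hr, hd⟩ := Finset.mem_filter.1 hr
    obtain rfl : d = .fin := hd
    exact Or.inr ⟨w, by rwa [maxFin, hsup]⟩

/-- What server `i` may reply to a request when its storage is `S` and the servers in `M` are
malicious. -/
def ValidReply (M : Finset (Fin N)) (S : Finset (Rec K C)) (i : Fin N) (req : Request K C)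
    (r : Rec K C) : Prop :=
  r = correctReply S req ∨ i ∈ M ∧ Corruption (correctReply S req) r

namespace ValidReply

variable {M : Finset (Fin N)} {i : Fin N} {r : Rec K C}

theorem tag_eq (h : ValidReply M S i req r) : r.tag = (correctReply S req).tag := by
  rcases h with rfl | h
  exacts [rfl, h.2.1]

theorem label_eq (h : ValidReply M S i req r) : r.label = (correctReply S req).label := by
  rcases h with rfl | h
  exacts [rfl, h.2.2.1]

theorem data_ne_none (h : ValidReply M S i req r) (hd : (correctReply S req).data ≠ none) :
    r.data ≠ none := by
  rcases h with rfl | h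
  exacts [hd, h.2.2.2 hd]

end ValidReply

theorem Tag.lt_next (t : Tag C) (c : C) : t < Tag.next t c := by
  induction t using WithBot.recBotCoe with
  | bot => exact WithBot.bot_lt_coe _
  | coe x =>
    refine WithBot.coe_lt_coe.2 (Prod.Lex.lt_iff.2 (Or.inl ?_))
    exact PNat.coe_lt_coe _ _ |>.1 (Nat.lt_succ_self _)

end Storage

/-! ### Steps of the system -/

section Client

variable {N k : ℕ} {K C : Type*}

theorem Client.shares_eq_data {cl : Client N k K C} {t : Tag C} {i : Fin N} {r : Rec K C}
    (h : cl.replies i = some r) (ht : r.tag = t) (hl : r.label = .fin) :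
    cl.shares t i = r.data := by
  simp [Client.shares, h, ht, hl]

theorem Client.maxTag_eq_bot_or_exists [LinearOrder C] (cl : Client N k K C) :
    cl.maxTag = ⊥ ∨ ∃ i r, cl.replies i = some r ∧ cl.maxTag = r.tag := by
  rcases (Finset.univ : Finset (Fin N)).eq_empty_or_nonempty with h | h
  · exact Or.inl (by rw [Client.maxTag, h, Finset.sup_empty])
  · obtain ⟨i, -, hi⟩ := Finset.exists_mem_eq_sup _ h fun i => (cl.replies i).elim ⊥ Rec.tag
    cases hr : cl.replies i with
    | none => exact Or.inl (hi.trans (by rw [hr]; rfl))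
    | some r => exact Or.inr ⟨i, r, hr, hi.trans (by rw [hr]; rfl)⟩

theorem Client.tag_le_maxTag [LinearOrder C] {cl : Client N k K C} {i : Fin N} {r : Rec K C}
    (h : cl.replies i = some r) : r.tag ≤ cl.maxTag :=
  calc r.tag = (cl.replies i).elim ⊥ Rec.tag := by rw [h]; rfl
    _ ≤ cl.maxTag :=
      Finset.le_sup (f := fun i => (cl.replies i).elim ⊥ Rec.tag) (Finset.mem_univ i)

/-- The tag that the current operation has selected in its query phase, if that is over. -/
def Phase.tag : Phase k K C → Option (Tag C)
  | .idle | .wQry _ | .rQry => none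
  | .wPre _ t | .wFin _ t | .rFin t => some t

/-- The action by which client `c` has invoked its current operation. -/
def Phase.invocation (N : ℕ) (c : C) : Phase k K C → Option (Action N k K C)
  | .idle => none
  | .wQry m | .wPre m _ | .wFin m _ => some (.invWrite c m)
  | .rQry | .rFin _ => some (.invRead c)

/-- A bound on the number of quorum accesses that are left, the current one included. -/
def Phase.remaining : Phase k K C → ℕ
  | .idle => 0
  | .wQry _ => 3
  | .wPre _ _ | .rQry => 2
  | .wFin _ _ | .rFin _ => 1

/-- The request that server `i` receives in a phase. -/
def Phase.request [Field K] (α : Fin N → K) : Phase k K C → Fin N → Option (Request K C)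
  | .idle, _ => none
  | .wQry _, _ | .rQry, _ => some .qry
  | .wPre m t, i => some (.pre t (encode α m i))
  | .wFin _ t, _ => some (.finW t)
  | .rFin t, _ => some (.finR t)

theorem Phase.invocation_ne_none_iff {ph : Phase k K C} {c : C} :
    ph.invocation N c ≠ none ↔ ph ≠ .idle := by
  cases ph <;> simp [invocation]

theorem Phase.exists_eq_wPre_of_request [Field K] {α : Fin N → K} {ph : Phase k K C} {i : Fin N}
    {t : Tag C} {w : K} (h : ph.request α i = some (.pre t w)) :
    ∃ m, ph = .wPre m t ∧ w = encode α m i := by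
  cases ph <;> simp_all [request]

theorem Phase.eq_wFin_or_rFin_of_request [Field K] {α : Fin N → K} {ph : Phase k K C} {i : Fin N}
    {t : Tag C} {req : Request K C} (h : ph.request α i = some req) (ht : req.Finalizes t) :
    (∃ m, ph = .wFin m t) ∨ ph = .rFin t := by
  cases ph <;> simp_all [request, Request.Finalizes] <;> grind

/-- Client `c` begins, continues or ends an operation by this action. -/
def Action.Moves (a : Action N k K C) (c : C) : Prop :=
  a.IsInv c ∨ a = .advance c ∨ a.IsRet c

theorem Action.IsInv.client_unique {a : Action N k K C} {c c' : C} (h : a.IsInv c)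
    (h' : a.IsInv c') : c = c' := by
  cases a <;> simp_all [IsInv]

theorem Action.Moves.client_unique {a : Action N k K C} {c c' : C} (h : a.Moves c)
    (h' : a.Moves c') : c = c' := by
  cases a <;> simp_all [Moves, IsInv, IsRet]

variable [Field K] [LinearOrder C] [NeZero k]

/-- The part of the step relation that concerns the state of client `c`. -/
inductive ClientStep (α : Fin N → K) (e : ℕ) (c : C) (cl : Client N k K C) :
    Action N k K C → Client N k K C → Prop
  | stay (a) (ha : ¬ a.Moves c) : ClientStep α e c cl a cl
  | receive (i r) :
      ClientStep α e c cl (.deliver (.reply i c cl.seq r))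
        { cl with replies := Function.update cl.replies i (some r) }
  | invWrite (m) (hp : cl.phase = .idle) :
      ClientStep α e c cl (.invWrite c m) ⟨.wQry m, cl.seq + 1, fun _ => none⟩
  | invRead (hp : cl.phase = .idle) :
      ClientStep α e c cl (.invRead c) ⟨.rQry, cl.seq + 1, fun _ => none⟩
  | preWrite (m) (hp : cl.phase = .wQry m) (hq : cl.HasQuorum e) :
      ClientStep α e c cl (.advance c) ⟨.wPre m (cl.maxTag.next c), cl.seq + 1, fun _ => none⟩
  | finalizeWrite (m t) (hp : cl.phase = .wPre m t) (hq : cl.HasQuorum e) :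
      ClientStep α e c cl (.advance c) ⟨.wFin m t, cl.seq + 1, fun _ => none⟩
  | retWrite (m t) (hp : cl.phase = .wFin m t) (hq : cl.HasQuorum e) :
      ClientStep α e c cl (.retWrite c) ⟨.idle, cl.seq, fun _ => none⟩
  | finalizeRead (hp : cl.phase = .rQry) (hq : cl.HasQuorum e) :
      ClientStep α e c cl (.advance c) ⟨.rFin cl.maxTag, cl.seq + 1, fun _ => none⟩
  | retRead (t) (hp : cl.phase = .rFin t) (hq : cl.HasQuorum e) :
      ClientStep α e c cl (.retRead c (cl.readResult α e t)) ⟨.idle, cl.seq, fun _ => none⟩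

namespace ClientStep

variable {α : Fin N → K} {e : ℕ} {c : C} {cl cl' : Client N k K C} {a : Action N k K C}

theorem update {clients : C → Client N k K C} {c' : C}
    (h : ClientStep α e c' (clients c') a cl') (ha : a.Moves c') (c : C) :
    ClientStep α e c (clients c) a (Function.update clients c' cl' c) := by
  rcases eq_or_ne c c' with rfl | hne
  · rwa [Function.update_self]
  · rw [Function.update_of_ne hne]
    exact .stay a fun hc => hne (hc.client_unique ha)

theorem of_isInv (h : ClientStep α e c cl a cl') (ha : a.IsInv c) :
    cl.phase = .idle ∧ cl'.phase.invocation N c = some a ∧ cl'.phase.tag = none ∧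
      cl'.seq = cl.seq + 1 := by
  cases h <;> simp_all [Action.Moves, Action.IsInv, Phase.invocation, Phase.tag]

theorem of_isRet (h : ClientStep α e c cl a cl') (ha : a.IsRet c) :
    cl'.phase = .idle ∧ cl.HasQuorum e ∧ ((∃ m t, cl.phase = .wFin m t ∧ a = .retWrite c) ∨
      ∃ t, cl.phase = .rFin t ∧ a = .retRead c (cl.readResult α e t)) := by
  cases h <;> simp_all [Action.Moves, Action.IsRet]

theorem of_advance (h : ClientStep α e c cl a cl') (ha : a = .advance c) :
    cl'.seq = cl.seq + 1 ∧ cl'.phase.remaining < cl.phase.remaining := by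
  cases h <;> simp_all [Action.Moves, Phase.remaining]

theorem invocation_eq (h : ClientStep α e c cl a cl') (h₁ : ¬ a.IsInv c) (h₂ : ¬ a.IsRet c) :
    cl'.phase.invocation N c = cl.phase.invocation N c := by
  cases h <;> simp_all [Action.IsInv, Action.IsRet, Phase.invocation]

theorem tag_eq (h : ClientStep α e c cl a cl') (h₁ : ¬ a.IsInv c) (h₂ : ¬ a.IsRet c) {t : Tag C}
    (ht : cl.phase.tag = some t) : cl'.phase.tag = some t := by
  cases h <;> simp_all [Action.IsInv, Action.IsRet, Phase.tag]

theorem remaining_le (h : ClientStep α e c cl a cl') (h₁ : ¬ a.IsInv c) :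
    cl'.phase.remaining ≤ cl.phase.remaining := by
  cases h <;> simp_all [Action.IsInv, Phase.remaining]

theorem of_tag (h : ClientStep α e c cl a cl') {t : Tag C} (ht : cl'.phase.tag = some t) :
    cl.phase.tag = some t ∨ cl.HasQuorum e ∧
      ((∃ m, cl.phase = .wQry m ∧ t = cl.maxTag.next c) ∨ cl.phase = .rQry ∧ t = cl.maxTag) := by
  cases h <;> simp_all [Phase.tag]

theorem of_wFin (h : ClientStep α e c cl a cl') {m : Fin k → K} {t : Tag C}
    (ht : cl'.phase = .wFin m t) :
    cl.phase = .wFin m t ∨ cl.phase = .wPre m t ∧ cl.HasQuorum e := by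
  cases h <;> simp_all

theorem seq_eq_or (h : ClientStep α e c cl a cl') :
    (cl'.seq = cl.seq ∧ (cl'.phase = cl.phase ∨ cl'.phase = .idle)) ∨ cl'.seq = cl.seq + 1 := by
  cases h <;> simp_all

theorem reply_origin (h : ClientStep α e c cl a cl') {i : Fin N} {r : Rec K C}
    (hr : cl'.replies i = some r) :
    cl'.seq = cl.seq ∧ (cl.replies i = some r ∨ a = .deliver (.reply i c cl'.seq r)) := by
  cases h with
  | stay => exact ⟨rfl, Or.inl hr⟩
  | receive i' r' =>
    refine ⟨rfl, ?_⟩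
    rcases eq_or_ne i i' with rfl | hne
    · obtain rfl : r' = r := by simpa using hr
      exact Or.inr rfl
    · exact Or.inl (by simpa [hne] using hr)
  | _ => cases hr

theorem of_not_moves (h : ClientStep α e c cl a cl') (ha : ¬ a.Moves c) :
    cl'.seq = cl.seq ∧ cl'.phase = cl.phase ∧
      ∀ i, cl.replies i ≠ none → cl'.replies i ≠ none := by
  cases h with
  | stay => exact ⟨rfl, rfl, fun _ => id⟩
  | receive i r =>
    refine ⟨rfl, rfl, fun j hj => ?_⟩
    rcases eq_or_ne j i with rfl | hne
    · simp
    · simpa [hne] using hj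
  | _ => simp [Action.Moves, Action.IsInv, Action.IsRet] at ha

end ClientStep

end Client

section Network

variable {N k : ℕ} {K C : Type*}

/-- A finalize request or a gossip message for tag `t` is in transit. -/
def Finalizing (net : Multiset (Msg N K C)) (t : Tag C) : Prop :=
  (∃ c i q req, Msg.request c i q req ∈ net ∧ req.Finalizes t) ∨ ∃ i j, Msg.gossip i j t ∈ net

theorem exists_eq_gossip_of_mem_gossipAfter {i : Fin N} {req : Request K C} {msg : Msg N K C}
    (h : msg ∈ gossipAfter i req) : ∃ j t, req.Finalizes t ∧ msg = .gossip i j t := by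
  cases req with
  | qry | pre => exact absurd h (Multiset.notMem_zero _)
  | finW t | finR t =>
    rw [gossipAfter, Multiset.mem_map] at h
    obtain ⟨j, -, rfl⟩ := h
    exact ⟨j, t, by simp [Request.Finalizes], rfl⟩

variable [Field K] [LinearOrder C]

/-- How a message that is in transit after the step from `s` to `s'` was sent in that step. -/
inductive Sent (α : Fin N → K) (M : Finset (Fin N)) (s s' : State N k K C) : Msg N K C → Prop
  | request (c i req) (hseq : (s'.client c).seq = (s.client c).seq + 1)
      (hreq : (s'.client c).phase.request α i = some req) :
      Sent α M s s' (.request c i (s'.client c).seq req)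
  | reply (i c q req r) (hnet : .request c i q req ∈ s.net)
      (hstorage : s'.storage i = storageAfter (s.storage i) req)
      (hr : ValidReply M (s.storage i) i req r) : Sent α M s s' (.reply i c q r)
  | gossip (i j t c q req) (hnet : .request c i q req ∈ s.net) (ht : req.Finalizes t) :
      Sent α M s s' (.gossip i j t)

variable {α : Fin N → K} {e : ℕ} {M : Finset (Fin N)} {s s' : State N k K C}
  {a : Action N k K C} {msg : Msg N K C}

theorem State.mem_net_or_sent_of_mem_access {c : C} {ph : Phase k K C} {req : Fin N → Request K C}
    (hreq : ∀ i, ph.request α i = some (req i)) (h : msg ∈ (s.access c ph req).net) :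
    msg ∈ s.net ∨ Sent α M s (s.access c ph req) msg := by
  rcases Multiset.mem_add.1 h with h | h
  · exact Or.inl h
  · obtain ⟨i, -, rfl⟩ := Multiset.mem_map.1 h
    have hc : (s.access c ph req).client c = ⟨ph, (s.client c).seq + 1, fun _ => none⟩ :=
      Function.update_self ..
    have hsent : Sent α M s (s.access c ph req) _ :=
      .request c i (req i) (by rw [hc]) (by rw [hc]; exact hreq i)
    rw [hc] at hsent
    exact Or.inr hsent

namespace Step

variable [NeZero k]

theorem client (h : Step α e M s a s') (c : C) :
    ClientStep α e c (s.client c) a (s'.client c) := by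
  have hstay : ∀ a : Action N k K C, (∀ c, ¬ a.Moves c) →
      ClientStep α e c (s.client c) a (s.client c) := fun a ha => .stay a (ha c)
  cases h with
  | idle | crash | request | gossip =>
    exact hstay _ (by simp [Action.Moves, Action.IsInv, Action.IsRet])
  | invWrite c' m _ hp => exact (ClientStep.invWrite m hp).update (.inl (.inr ⟨m, rfl⟩)) c
  | invRead c' _ hp => exact (ClientStep.invRead hp).update (.inl (.inl rfl)) c
  | preWrite c' m _ hp hq => exact (ClientStep.preWrite m hp hq).update (.inr (.inl rfl)) c
  | finalizeWrite c' m t _ hp hq =>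
    exact (ClientStep.finalizeWrite m t hp hq).update (.inr (.inl rfl)) c
  | retWrite c' m t _ hp hq =>
    exact (ClientStep.retWrite m t hp hq).update (.inr (.inr (.inl rfl))) c
  | finalizeRead c' _ hp hq => exact (ClientStep.finalizeRead hp hq).update (.inr (.inl rfl)) c
  | retRead c' t _ hp hq =>
    exact (ClientStep.retRead t hp hq).update (.inr (.inr (.inr ⟨_, rfl⟩))) c
  | reply i c' q r =>
    have hmoves : ¬ Action.Moves (.deliver (.reply i c' q r) : Action N k K C) c := by
      simp [Action.Moves, Action.IsInv, Action.IsRet]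
    rcases eq_or_ne c c' with rfl | hc
    · by_cases hq : q = (s.client c).seq
      · subst hq
        simpa [State.receive] using ClientStep.receive (cl := s.client c) i r
      · simpa [State.receive, hq] using ClientStep.stay (cl := s.client c) _ hmoves
    · simpa [State.receive, hc] using ClientStep.stay (cl := s.client c) _ hmoves

theorem mem_net_or_sent (h : Step α e M s a s') (hm : msg ∈ s'.net) :
    msg ∈ s.net ∨ Sent α M s s' msg := by
  cases h with
  | idle | crash | retWrite | retRead => exact Or.inl hm
  | invWrite | invRead | preWrite | finalizeWrite | finalizeRead =>
    exact State.mem_net_or_sent_of_mem_access (fun _ => rfl) hm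
  | request c i q req rest r _ hnet hr =>
    have hreq : Msg.request c i q req ∈ s.net := hnet ▸ Multiset.mem_cons_self _ _
    rcases Multiset.mem_add.1 hm with hm | hm
    · exact Or.inl (hnet ▸ Multiset.mem_cons_of_mem hm)
    · rcases Multiset.mem_cons.1 hm with rfl | hm
      · exact Or.inr (.reply i c q req r hreq (Function.update_self ..) hr)
      · obtain ⟨j, t, ht, rfl⟩ := exists_eq_gossip_of_mem_gossipAfter hm
        exact Or.inr (.gossip i j t c q req hreq ht)
  | gossip i j t rest _ hnet => exact Or.inl (hnet ▸ Multiset.mem_cons_of_mem hm)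
  | reply i c q r rest _ hnet => exact Or.inl (hnet ▸ Multiset.mem_cons_of_mem hm)

theorem finalizing_or (h : Step α e M s a s') {t : Tag C} (ht : Finalizing s'.net t) :
    Finalizing s.net t ∨
      ∃ c, (∃ m, (s'.client c).phase = .wFin m t) ∨ (s'.client c).phase = .rFin t := by
  rcases ht with ⟨c, i, q, req, hreq, ht⟩ | ⟨i, j, hgossip⟩
  · rcases h.mem_net_or_sent hreq with hreq | hsent
    · exact Or.inl (Or.inl ⟨c, i, q, req, hreq, ht⟩)
    · cases hsent with
      | request _ _ _ _ hphase => exact Or.inr ⟨c, Phase.eq_wFin_or_rFin_of_request hphase ht⟩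
  · rcases h.mem_net_or_sent hgossip with hgossip | hsent
    · exact Or.inl (Or.inr ⟨i, j, hgossip⟩)
    · cases hsent with
      | gossip _ _ _ c q req hreq ht => exact Or.inl (Or.inl ⟨c, i, q, req, hreq, ht⟩)

theorem storageStep (h : Step α e M s a s') (i : Fin N) :
    StorageStep (Finalizing s.net) (fun t w => ∃ c q, Msg.request c i q (.pre t w) ∈ s.net)
      (s.storage i) (s'.storage i) := by
  cases h with
  | request c i' q req rest r _ hnet =>
    have hreq : Msg.request c i' q req ∈ s.net := hnet ▸ Multiset.mem_cons_self _ _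
    rcases eq_or_ne i i' with rfl | hi
    · simp only [Function.update_self]
      exact (storageStep_storageAfter (s.storage i) req).mono
        (fun t ht => Or.inl ⟨c, i, q, req, hreq, ht⟩) fun t w hw => ⟨c, q, hw ▸ hreq⟩
    · simpa only [Function.update_of_ne hi] using StorageStep.refl
  | gossip i' j t rest _ hnet =>
    have hgossip : Msg.gossip i' j t ∈ s.net := hnet ▸ Multiset.mem_cons_self _ _
    rcases eq_or_ne i j with rfl | hi
    · simp only [Function.update_self]
      exact (storageStep_storageAfterGossip (s.storage i) t).mono
        (fun u hu => Or.inr ⟨i', i, hu ▸ hgossip⟩) fun _ _ => False.elim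
    · simpa only [Function.update_of_ne hi] using StorageStep.refl
  | _ => exact .refl

theorem exists_request_mem (h : Step α e M s a s') {c : C}
    (hseq : (s'.client c).seq = (s.client c).seq + 1) (i : Fin N) :
    ∃ req, Msg.request c i (s'.client c).seq req ∈ s'.net := by
  have haccess : ∀ c' (ph : Phase k K C) (req : Fin N → Request K C),
      ((s.access c' ph req).client c).seq = (s.client c).seq + 1 →
        ∃ req', Msg.request c i ((s.access c' ph req).client c).seq req' ∈
          (s.access c' ph req).net := by
    intro c' ph req hseq
    obtain rfl : c = c' := by
      by_contra hc
      simp [State.access, hc] at hseq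
    exact ⟨req i, by simp [State.access]⟩
  cases h with
  | invWrite | invRead | preWrite | finalizeWrite | finalizeRead => exact haccess _ _ _ hseq
  | idle | crash | request | gossip => simp at hseq
  | retWrite c' | retRead c' =>
    rcases eq_or_ne c c' with rfl | hc <;> simp_all [State.finish]
  | reply i' c' q r =>
    rcases eq_or_ne c c' with rfl | hc
    · simp only [State.receive, Function.update_self] at hseq
      split_ifs at hseq <;> simp at hseq
    · simp [State.receive, hc] at hseq

theorem mem_net_of_deliver (h : Step α e M s (.deliver msg) s') : msg ∈ s.net := by
  cases h with
  | request _ _ _ _ _ _ _ hnet => exact hnet ▸ Multiset.mem_cons_self _ _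
  | gossip _ _ _ _ _ hnet => exact hnet ▸ Multiset.mem_cons_self _ _
  | reply _ _ _ _ _ _ hnet => exact hnet ▸ Multiset.mem_cons_self _ _

theorem exists_reply_of_deliver_request {c : C} {i : Fin N} {q : ℕ} {req : Request K C}
    (h : Step α e M s (.deliver (.request c i q req)) s') : ∃ r, Msg.reply i c q r ∈ s'.net := by
  cases h with
  | request _ _ _ _ _ r => exact ⟨r, by simp⟩

theorem replies_ne_none_of_deliver_reply {c : C} {i : Fin N} {q : ℕ} {r : Rec K C}
    (h : Step α e M s (.deliver (.reply i c q r)) s') (hq : q = (s.client c).seq) :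
    (s'.client c).replies i ≠ none := by
  cases h with
  | reply => simp [State.receive, hq]

end Step

end Network

/-! ### Operations and quorum accesses -/

namespace Execution

variable {N k : ℕ} [NeZero k] {K C : Type*} [Field K] [LinearOrder C]
  {α : Fin N → K} {e : ℕ} {m₀ : Fin k → K} {M : Finset (Fin N)}

section Operations

variable (E : Execution C α e m₀ M)

/-- The state of client `c` at time `j`. -/
abbrev client (c : C) (j : ℕ) : Client N k K C := (E.state j).client c

/-- At time `j`, client `c` is in the operation that it invoked at time `n`. -/
def Running (c : C) (n j : ℕ) : Prop :=
  (E.act n).IsInv c ∧ n < j ∧ ∀ l, n < l → l < j → ¬ (E.act l).IsRet c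

theorem clientStep (c : C) (j : ℕ) :
    ClientStep α e c (E.client c j) (E.act j) (E.client c (j + 1)) :=
  (E.step j).client c

theorem client_zero (c : C) : E.client c 0 = ⟨.idle, 0, fun _ => none⟩ := by
  rw [client, E.init, initState]

variable {E} {c : C} {n n' i j : ℕ} {t u : Tag C} {m m' : Fin k → K}

theorem exists_running (h : (E.client c j).phase ≠ .idle) : ∃ n, E.Running c n j := by
  induction j with
  | zero => simp [client_zero] at h
  | succ j ih =>
    by_cases hinv : (E.act j).IsInv c
    · exact ⟨j, hinv, j.lt_succ_self, fun l hl hlj => by omega⟩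
    have hret : ¬ (E.act j).IsRet c := fun hret => h ((E.clientStep c j).of_isRet hret).1
    rw [← Phase.invocation_ne_none_iff (N := N) (c := c),
      (E.clientStep c j).invocation_eq hinv hret, Phase.invocation_ne_none_iff] at h
    obtain ⟨n, hn, hnj, hno⟩ := ih h
    refine ⟨n, hn, hnj.trans j.lt_succ_self, fun l hl hlj => ?_⟩
    rcases Nat.lt_succ_iff_lt_or_eq.1 hlj with hlj | rfl
    exacts [hno l hl hlj, hret]

namespace Running

theorem of_le (h : E.Running c n j) (hni : n < i) (hij : i ≤ j) : E.Running c n i :=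
  ⟨h.1, hni, fun l hl hli => h.2.2 l hl (hli.trans_le hij)⟩

theorem invocation_eq (h : E.Running c n j) :
    (E.client c j).phase.invocation N c = some (E.act n) := by
  obtain ⟨hinv, hnj, hno⟩ := h
  induction j, hnj using Nat.le_induction with
  | base => exact ((E.clientStep c n).of_isInv hinv).2.1
  | succ j hnj ih =>
    have hj := ih fun l hl hlj => hno l hl (hlj.trans j.lt_succ_self)
    have hinv' : ¬ (E.act j).IsInv c := fun h => by
      simp [((E.clientStep c j).of_isInv h).1, Phase.invocation] at hj
    rw [(E.clientStep c j).invocation_eq hinv' (hno j hnj j.lt_succ_self), hj]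

theorem phase_ne_idle (h : E.Running c n j) : (E.client c j).phase ≠ .idle :=
  Phase.invocation_ne_none_iff.1 (h.invocation_eq ▸ Option.some_ne_none _)

theorem not_isInv (h : E.Running c n j) : ¬ (E.act j).IsInv c := fun hinv =>
  h.phase_ne_idle ((E.clientStep c j).of_isInv hinv).1

theorem unique (h : E.Running c n j) (h' : E.Running c n' j) : n = n' := by
  rcases lt_trichotomy n n' with hlt | rfl | hlt
  · exact absurd h'.1 (h.of_le hlt h'.2.1.le).not_isInv
  · rfl
  · exact absurd h.1 (h'.of_le hlt h.2.1.le).not_isInv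

theorem tag_eq (h : E.Running c n j) (hni : n < i) (hij : i ≤ j)
    (ht : (E.client c i).phase.tag = some t) : (E.client c j).phase.tag = some t := by
  induction j, hij using Nat.le_induction with
  | base => exact ht
  | succ j hij ih =>
    have hj : E.Running c n j := h.of_le (hni.trans_le hij) j.le_succ
    exact (E.clientStep c j).tag_eq hj.not_isInv (h.2.2 j hj.2.1 j.lt_succ_self) (ih hj)

theorem remaining_le (h : E.Running c n j) (hni : n < i) (hij : i ≤ j) :
    (E.client c j).phase.remaining ≤ (E.client c i).phase.remaining := by
  induction j, hij using Nat.le_induction with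
  | base => exact le_rfl
  | succ j hij ih =>
    have hj : E.Running c n j := h.of_le (hni.trans_le hij) j.le_succ
    exact ((E.clientStep c j).remaining_le hj.not_isInv).trans (ih hj)

theorem act_eq_invWrite (h : E.Running c n j)
    (hp : (E.client c j).phase.invocation N c = some (.invWrite c m)) :
    E.act n = .invWrite c m :=
  Option.some.inj (h.invocation_eq.symm.trans hp)

theorem act_eq_invRead (h : E.Running c n j)
    (hp : (E.client c j).phase.invocation N c = some (.invRead c)) : E.act n = .invRead c :=
  Option.some.inj (h.invocation_eq.symm.trans hp)

end Running

theorem exists_returns_of_isRet (hn : (E.act n).IsInv c) (hnj : n < j) (hj : (E.act j).IsRet c) :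
    ∃ l ≤ j, E.Returns n l := by
  classical
  have hret : ∃ l, n < l ∧ (E.act l).IsRet c := ⟨j, hnj, hj⟩
  exact ⟨Nat.find hret, Nat.find_min' hret ⟨hnj, hj⟩, c, hn, (Nat.find_spec hret).1,
    (Nat.find_spec hret).2, fun i hni hi hiret => Nat.find_min hret hi ⟨hni, hiret⟩⟩

theorem exists_returns_of_isInv (hn : (E.act n).IsInv c) (hn' : (E.act n').IsInv c)
    (hlt : n < n') : ∃ l < n', E.Returns n l := by
  obtain ⟨l, hnl, hln', hl⟩ : ∃ l, n < l ∧ l < n' ∧ (E.act l).IsRet c := by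
    by_contra! hno
    exact Running.not_isInv (E := E) ⟨hn, hlt, hno⟩ hn'
  obtain ⟨i, hi, hret⟩ := exists_returns_of_isRet hn hnl hl
  exact ⟨i, hi.trans_lt hln', hret⟩

end Operations

section Accesses

variable {E : Execution C α e m₀ M} {c : C} {n a j : ℕ}

theorem seq_mono (c : C) : Monotone fun j => (E.client c j).seq :=
  monotone_nat_of_le_succ fun j => by rcases (E.clientStep c j).seq_eq_or with h | h <;> omega

theorem access_unique {a a' q : ℕ} (ha : (E.client c a).seq < q)
    (ha₁ : (E.client c (a + 1)).seq = q) (ha' : (E.client c a').seq < q)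
    (ha₁' : (E.client c (a' + 1)).seq = q) : a = a' := by
  rcases lt_trichotomy a a' with hlt | rfl | hlt
  · have hle : (E.client c (a + 1)).seq ≤ (E.client c a').seq := seq_mono c hlt
    omega
  · rfl
  · have hle : (E.client c (a' + 1)).seq ≤ (E.client c a).seq := seq_mono c hlt
    omega

theorem exists_access_start (h : (E.client c j).phase ≠ .idle) :
    ∃ a < j, (E.client c a).seq + 1 = (E.client c j).seq ∧
      (E.client c (a + 1)).seq = (E.client c j).seq ∧
      (E.client c (a + 1)).phase = (E.client c j).phase := by
  induction j with
  | zero => simp [client_zero] at h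
  | succ j ih =>
    rcases (E.clientStep c j).seq_eq_or with ⟨hseq, hphase⟩ | hseq
    · rw [hseq, hphase.resolve_right h]
      obtain ⟨a, haj, hspec⟩ := ih (hphase.resolve_right h ▸ h)
      exact ⟨a, haj.trans j.lt_succ_self, hspec⟩
    · exact ⟨j, j.lt_succ_self, hseq.symm, rfl, rfl⟩

theorem exists_sent_of_request_mem {i : Fin N} {q : ℕ} {req : Request K C}
    (h : Msg.request c i q req ∈ (E.state j).net) :
    ∃ a < j, (E.client c a).seq + 1 = q ∧ (E.client c (a + 1)).seq = q ∧
      (E.client c (a + 1)).phase.request α i = some req := by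
  induction j with
  | zero => simp [E.init, initState] at h
  | succ j ih =>
    rcases (E.step j).mem_net_or_sent h with h | h
    · obtain ⟨a, haj, hspec⟩ := ih h
      exact ⟨a, haj.trans j.lt_succ_self, hspec⟩
    · cases h with
      | request _ _ _ hseq hreq => exact ⟨j, j.lt_succ_self, hseq.symm, rfl, hreq⟩

variable (E) in
/-- At time `b`, server `i` performs the request `req` and sends the reply `r`. -/
structure Handles (b : ℕ) (i : Fin N) (req : Request K C) (r : Rec K C) : Prop where
  storage_eq : (E.state (b + 1)).storage i = storageAfter ((E.state b).storage i) req
  validReply : ValidReply M ((E.state b).storage i) i req r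

theorem exists_handles_of_reply_mem {i : Fin N} {q : ℕ} {r : Rec K C}
    (h : Msg.reply i c q r ∈ (E.state j).net) :
    ∃ b < j, ∃ req, Msg.request c i q req ∈ (E.state b).net ∧ E.Handles b i req r := by
  induction j with
  | zero => simp [E.init, initState] at h
  | succ j ih =>
    rcases (E.step j).mem_net_or_sent h with h | h
    · obtain ⟨b, hbj, hspec⟩ := ih h
      exact ⟨b, hbj.trans j.lt_succ_self, hspec⟩
    · cases h with
      | reply _ _ _ req _ hnet hstorage hr =>
        exact ⟨j, j.lt_succ_self, req, hnet, hstorage, hr⟩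

theorem exists_reply_mem_of_replies {i : Fin N} {r : Rec K C}
    (h : (E.client c j).replies i = some r) :
    ∃ b < j, Msg.reply i c (E.client c j).seq r ∈ (E.state b).net := by
  induction j with
  | zero => simp [client_zero] at h
  | succ j ih =>
    obtain ⟨hseq, hold | hact⟩ := (E.clientStep c j).reply_origin h
    · obtain ⟨b, hbj, hmem⟩ := ih hold
      exact ⟨b, hbj.trans j.lt_succ_self, hseq ▸ hmem⟩
    · exact ⟨j, j.lt_succ_self, (hact ▸ E.step j).mem_net_of_deliver⟩

-- Since replies repeat the number of the access, none that arrived was sent before the access.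
theorem Running.exists_access (h : E.Running c n j) :
    ∃ a < j, n ≤ a ∧ (E.client c (a + 1)).phase = (E.client c j).phase ∧
      ∀ i r, (E.client c j).replies i = some r → ∃ b req, a < b ∧ b < j ∧
        (E.client c j).phase.request α i = some req ∧ E.Handles b i req r := by
  obtain ⟨a, haj, hseq, hseq₁, hphase⟩ := exists_access_start h.phase_ne_idle
  refine ⟨a, haj, ?_, hphase, fun i r hr => ?_⟩
  · by_contra! han
    have hinv := ((E.clientStep c n).of_isInv h.1).2.2.2
    have hle : (E.client c (a + 1)).seq ≤ (E.client c n).seq := seq_mono c han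
    have hle' : (E.client c (n + 1)).seq ≤ (E.client c j).seq := seq_mono c h.2.1
    omega
  · obtain ⟨b', hb', hreply⟩ := exists_reply_mem_of_replies hr
    obtain ⟨b, hb, req, hreq, hhandles⟩ := exists_handles_of_reply_mem hreply
    obtain ⟨a', ha'b, hseq', hseq₁', hreq⟩ := exists_sent_of_request_mem hreq
    obtain rfl : a = a' := access_unique (by omega) hseq₁ (by omega) hseq₁'
    exact ⟨b, req, ha'b, hb.trans hb', hphase ▸ hreq, hhandles⟩

end Accesses

section SelectedTags

variable {E : Execution C α e m₀ M} {c : C} {n n' i j : ℕ} {t u : Tag C} {m m' : Fin k → K}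

theorem Running.exists_query (h : E.Running c n j) (ht : (E.client c j).phase.tag = some t) :
    ∃ l, E.Running c n l ∧ l < j ∧ (E.client c l).HasQuorum e ∧
      ((∃ m, (E.client c l).phase = .wQry m ∧ t = (E.client c l).maxTag.next c) ∨
        (E.client c l).phase = .rQry ∧ t = (E.client c l).maxTag) := by
  obtain ⟨hinv, hnj, hno⟩ := h
  induction j, hnj using Nat.le_induction with
  | base => simp [((E.clientStep c n).of_isInv hinv).2.2.1] at ht
  | succ j hnj ih =>
    have hj : E.Running c n j := ⟨hinv, hnj, fun l hl hlj => hno l hl (hlj.trans j.lt_succ_self)⟩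
    rcases (E.clientStep c j).of_tag ht with ht | ⟨hq, hquery⟩
    · obtain ⟨l, hl, hlj, hspec⟩ := ih ht hj.2.2
      exact ⟨l, hl, hlj.trans j.lt_succ_self, hspec⟩
    · exact ⟨j, hj, j.lt_succ_self, hq, hquery⟩

variable (E) in
/-- The operation invoked at time `n` selects the tag `t` in its query phase. -/
def SelectsTag (n : ℕ) (t : Tag C) : Prop :=
  ∃ c j, E.Running c n j ∧ (E.client c j).phase.tag = some t

theorem SelectsTag.unique (h : E.SelectsTag n t) (h' : E.SelectsTag n u) : t = u := by
  obtain ⟨c, j, hrun, ht⟩ := h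
  obtain ⟨c', j', hrun', hu⟩ := h'
  obtain rfl := hrun.1.client_unique hrun'.1
  rcases le_total j j' with hle | hle
  · exact Option.some.inj ((hrun'.tag_eq hrun.2.1 hle ht).symm.trans hu)
  · exact Option.some.inj (ht.symm.trans (hrun.tag_eq hrun'.2.1 hle hu))

theorem SelectsTag.exists_eq_next (h : E.SelectsTag n t) (hn : E.act n = .invWrite c m) :
    ∃ u : Tag C, t = u.next c := by
  obtain ⟨c', j, hrun, ht⟩ := h
  obtain ⟨l, hl, -, -, ⟨m', hp, rfl⟩ | ⟨hp, -⟩⟩ := hrun.exists_query ht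
  · have hact : E.act n = .invWrite c' m' := hl.act_eq_invWrite (by rw [hp]; rfl)
    cases hn.symm.trans hact
    exact ⟨_, rfl⟩
  · cases hn.symm.trans (hl.act_eq_invRead (by rw [hp]; rfl))

theorem SelectsTag.ne_bot (h : E.SelectsTag n t) (hn : E.act n = .invWrite c m) : t ≠ ⊥ := by
  obtain ⟨u, rfl⟩ := h.exists_eq_next hn
  exact (bot_le.trans_lt (Tag.lt_next u c)).ne'

theorem hasFin_mono {i j : ℕ} (hij : i ≤ j) {s : Fin N} (h : HasFin ((E.state i).storage s) t) :
    HasFin ((E.state j).storage s) t := by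
  induction j, hij using Nat.le_induction with
  | base => exact h
  | succ j _ ih => exact ((E.step j).storageStep s).hasFin_mono ih

theorem hasShare_mono {i j : ℕ} (hij : i ≤ j) {s : Fin N}
    (h : HasShare ((E.state i).storage s) t) : HasShare ((E.state j).storage s) t := by
  induction j, hij using Nat.le_induction with
  | base => exact h
  | succ j _ ih => exact ((E.step j).storageStep s).hasShare_mono ih

variable (E) in
/-- At time `j`, the tag `t` is finalized at a quorum of servers. -/
def FinQuorum (j : ℕ) (t : Tag C) : Prop :=
  ∃ Q : Finset (Fin N), quorumSize N k e ≤ Q.card ∧ ∀ i ∈ Q, HasFin ((E.state j).storage i) t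

theorem FinQuorum.mono (h : E.FinQuorum i t) (hij : i ≤ j) : E.FinQuorum j t :=
  let ⟨Q, hQ, hfin⟩ := h
  ⟨Q, hQ, fun s hs => hasFin_mono hij (hfin s hs)⟩

theorem Running.finQuorum (h : E.Running c n j) (hq : (E.client c j).HasQuorum e)
    (hreq : ∀ i req, (E.client c j).phase.request α i = some req → req.Finalizes t) :
    E.FinQuorum j t := by
  obtain ⟨Q, hQ, hreplies⟩ := hq.exists_finset
  obtain ⟨a, -, -, -, haccess⟩ := h.exists_access
  refine ⟨Q, hQ, fun i hi => ?_⟩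
  obtain ⟨r, hr⟩ := hreplies i hi
  obtain ⟨b, req, -, hbj, hphase, hhandles⟩ := haccess i r hr
  refine hasFin_mono hbj ?_
  rw [hhandles.storage_eq]
  exact hasFin_storageAfter _ (hreq i req hphase)

theorem Returns.exists_finQuorum (h : E.Returns n n') :
    ∃ t, E.SelectsTag n t ∧ E.FinQuorum n' t := by
  obtain ⟨c, hinv, hlt, hret, hno⟩ := h
  have hrun : E.Running c n n' := ⟨hinv, hlt, hno⟩
  obtain ⟨-, hq, ⟨m, t, hp, -⟩ | ⟨t, hp, -⟩⟩ := (E.clientStep c n').of_isRet hret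
  · refine ⟨t, ⟨c, n', hrun, by rw [hp]; rfl⟩, hrun.finQuorum hq fun i req hreq => ?_⟩
    rw [hp] at hreq
    exact Or.inl (Option.some.inj hreq).symm
  · refine ⟨t, ⟨c, n', hrun, by rw [hp]; rfl⟩, hrun.finQuorum hq fun i req hreq => ?_⟩
    rw [hp] at hreq
    exact Or.inr (Option.some.inj hreq).symm

-- A server in both quorums has finalized `t` before it answers the query.
theorem FinQuorum.le_maxTag (h : E.FinQuorum n t) (hrun : E.Running c n' j) (hle : n ≤ n')
    (hq : (E.client c j).HasQuorum e)
    (hqry : ∀ i, (E.client c j).phase.request α i = some .qry) : t ≤ (E.client c j).maxTag := by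
  obtain ⟨Q, hQ, hfin⟩ := h
  obtain ⟨Q', hQ', hreplies⟩ := hq.exists_finset
  have hcard := le_card_inter_of_quorumSize_le hQ hQ'
  have hk := NeZero.pos k
  obtain ⟨i, hi⟩ : (Q ∩ Q').Nonempty := Finset.card_pos.1 (by omega)
  obtain ⟨hiQ, hiQ'⟩ := Finset.mem_inter.1 hi
  obtain ⟨r, hr⟩ := hreplies i hiQ'
  obtain ⟨a, -, hna, -, haccess⟩ := hrun.exists_access
  obtain ⟨b, req, hab, -, hphase, hhandles⟩ := haccess i r hr
  obtain rfl : req = .qry := Option.some.inj (hphase.symm.trans (hqry i))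
  calc t ≤ maxFin ((E.state b).storage i) := (hasFin_mono (by omega) (hfin i hiQ)).le_maxFin
    _ = r.tag := hhandles.validReply.tag_eq.symm
    _ ≤ (E.client c j).maxTag := Client.tag_le_maxTag hr

theorem SelectsTag.le_of_finQuorum (h : E.SelectsTag n t) (hu : E.FinQuorum i u) (hin : i ≤ n) :
    u ≤ t ∧ ∀ c m, E.act n = .invWrite c m → u < t := by
  obtain ⟨c, j, hrun, ht⟩ := h
  obtain ⟨l, hl, -, hq, ⟨m, hp, rfl⟩ | ⟨hp, rfl⟩⟩ := hrun.exists_query ht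
  · have hle := hu.le_maxTag hl hin hq fun i => by rw [hp]; rfl
    have hlt := hle.trans_lt (Tag.lt_next _ c)
    exact ⟨hlt.le, fun _ _ _ => hlt⟩
  · refine ⟨hu.le_maxTag hl hin hq fun i => by rw [hp]; rfl, fun c' m hact => ?_⟩
    cases hact.symm.trans (hl.act_eq_invRead (by rw [hp]; rfl))

theorem SelectsTag.le_of_returns (h : E.SelectsTag n t) (h' : E.SelectsTag n' u)
    (hret : E.Returns n i) (hin : i ≤ n') : t ≤ u ∧ ∀ c m, E.act n' = .invWrite c m → t < u := by
  obtain ⟨t', ht', hfin⟩ := hret.exists_finQuorum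
  obtain rfl := h.unique ht'
  exact h'.le_of_finQuorum hfin hin

theorem SelectsTag.write_injective {c c' : C} (h : E.SelectsTag n t) (h' : E.SelectsTag n' t)
    (hn : E.act n = .invWrite c m) (hn' : E.act n' = .invWrite c' m') : n = n' := by
  obtain ⟨u, rfl⟩ := h.exists_eq_next hn
  obtain ⟨u', heq⟩ := h'.exists_eq_next hn'
  obtain rfl : c = c' := (Prod.ext_iff.1 (WithBot.coe_inj.1 heq)).2
  have hinv : (E.act n).IsInv c := Or.inr ⟨m, hn⟩
  have hinv' : (E.act n').IsInv c := Or.inr ⟨m', hn'⟩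
  rcases lt_trichotomy n n' with hlt | rfl | hlt
  · obtain ⟨l, hl, hret⟩ := exists_returns_of_isInv hinv hinv' hlt
    exact absurd ((h.le_of_returns h' hret hl.le).2 _ _ hn') (lt_irrefl _)
  · rfl
  · obtain ⟨l, hl, hret⟩ := exists_returns_of_isInv hinv' hinv hlt
    exact absurd ((h'.le_of_returns h hret hl.le).2 _ _ hn) (lt_irrefl _)

end SelectedTags

end Execution

/-! ### Finalized tags and reads -/

namespace Execution

variable {N k : ℕ} [NeZero k] {K C : Type*} [Field K] [LinearOrder C]
  {α : Fin N → K} {e : ℕ} {m₀ : Fin k → K} {M : Finset (Fin N)} {E : Execution C α e m₀ M}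
  {c : C} {i j n : ℕ} {t : Tag C} {m m' : Fin k → K} {s : Fin N}

variable (E) in
/-- The tag `t` belongs to the message vector `m`: either a write of `m` has selected `t`, or `t`
is the default tag and `m` the initial message vector. -/
def Tagged (t : Tag C) (m : Fin k → K) : Prop :=
  (t = ⊥ ∧ m = m₀) ∨ ∃ n c, E.act n = .invWrite c m ∧ E.SelectsTag n t

theorem Tagged.unique (h : E.Tagged t m) (h' : E.Tagged t m') : m = m' := by
  rcases h with ⟨ht, hm⟩ | ⟨n, c, hn, ht⟩ <;> rcases h' with ⟨ht', hm'⟩ | ⟨n', c', hn', ht'⟩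
  · exact hm.trans hm'.symm
  · exact absurd ht (ht'.ne_bot hn')
  · exact absurd ht' (ht.ne_bot hn)
  · obtain rfl := ht.write_injective ht' hn hn'
    cases hn.symm.trans hn'
    rfl

theorem exists_running_write (ht : (E.client c j).phase.tag = some t)
    (hm : (E.client c j).phase.invocation N c = some (.invWrite c m)) :
    ∃ n, E.Running c n j ∧ E.act n = .invWrite c m ∧ E.SelectsTag n t := by
  obtain ⟨n, hrun⟩ := exists_running
    (Phase.invocation_ne_none_iff.1 (hm ▸ Option.some_ne_none (Action.invWrite c m)))
  exact ⟨n, hrun, hrun.act_eq_invWrite hm, c, j, hrun, ht⟩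

theorem Finalized.tagged (h : E.Finalized n t m) : E.Tagged t m := by
  refine h.imp_right fun ⟨j, _, c, hp⟩ => ?_
  obtain ⟨n, -, hn, ht⟩ := exists_running_write (E := E) (c := c) (j := j) (t := t) (m := m)
    (by rw [hp]; rfl) (by rw [hp]; rfl)
  exact ⟨n, c, hn, ht⟩

theorem Finalized.mono (h : E.Finalized i t m) (hij : i ≤ j) : E.Finalized j t m :=
  h.imp_right fun ⟨n, hn, hspec⟩ => ⟨n, hn.trans_le hij, hspec⟩

theorem eq_bot_or_hasFin_of_rFin (h : (E.client c j).phase = .rFin t) :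
    t = ⊥ ∨ ∃ b < j, ∃ s, HasFin ((E.state b).storage s) t := by
  obtain ⟨n, hrun⟩ := exists_running (E := E) (c := c) (j := j) (by simp [h])
  obtain ⟨l, hl, hlj, -, ⟨m, hp, -⟩ | ⟨hp, rfl⟩⟩ := hrun.exists_query (t := t) (by rw [h]; rfl)
  · cases (hl.act_eq_invWrite (by rw [hp]; rfl)).symm.trans (hrun.act_eq_invRead (by rw [h]; rfl))
  rcases (E.client c l).maxTag_eq_bot_or_exists with hbot | ⟨s, r, hr, hmax⟩
  · exact Or.inl hbot
  obtain ⟨a, -, -, -, haccess⟩ := hl.exists_access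
  obtain ⟨b, req, -, hbl, hreq, hhandles⟩ := haccess s r hr
  rw [hp] at hreq
  cases hreq
  have htag : r.tag = maxFin ((E.state b).storage s) := hhandles.validReply.tag_eq
  rw [hmax, htag]
  exact (maxFin_eq_bot_or_hasFin _).imp_right fun hfin => ⟨b, hbl.trans hlj, s, hfin⟩

theorem exists_finalized_of_hasFin_or_finalizing (j : ℕ) (t : Tag C) :
    ((∃ s, HasFin ((E.state j).storage s) t) → ∃ m, E.Finalized j t m) ∧
      (Finalizing (E.state j).net t → ∃ m, E.Finalized (j + 1) t m) := by
  induction j with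
  | zero =>
    refine ⟨fun ⟨s, w, hw⟩ => ⟨m₀, Or.inl ⟨?_, rfl⟩⟩, fun h => ?_⟩
    · simp only [E.init, initState, Finset.mem_singleton, Rec.mk.injEq] at hw
      exact hw.1
    · simp [E.init, initState, Finalizing] at h
  | succ j ih =>
    have hfin : (∃ s, HasFin ((E.state j).storage s) t) → ∃ m, E.Finalized (j + 1) t m :=
      fun h => (ih.1 h).imp fun m hm => hm.mono j.le_succ
    refine ⟨fun ⟨s, hs⟩ => ?_, fun h => ?_⟩
    · exact (((E.step j).storageStep s).hasFin_or_fin hs).elim (fun hs => hfin ⟨s, hs⟩) ih.2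
    · rcases (E.step j).finalizing_or h with h | ⟨c, ⟨m, hp⟩ | hp⟩
      · exact (ih.2 h).imp fun m hm => hm.mono (j + 1).le_succ
      · exact ⟨m, Or.inr ⟨j + 1, (j + 1).lt_succ_self, c, hp⟩⟩
      · rcases eq_bot_or_hasFin_of_rFin hp with rfl | ⟨b, hb, s, hs⟩
        · exact ⟨m₀, Or.inl ⟨rfl, rfl⟩⟩
        · obtain ⟨m, hm⟩ := hfin ⟨s, hasFin_mono (Nat.lt_succ_iff.1 hb) hs⟩
          exact ⟨m, hm.mono (j + 1).le_succ⟩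

theorem exists_finalized_of_hasFin (h : HasFin ((E.state j).storage s) t) :
    ∃ m, E.Finalized j t m :=
  (exists_finalized_of_hasFin_or_finalizing j t).1 ⟨s, h⟩

theorem exists_finalized_of_rFin (h : (E.client c j).phase = .rFin t) :
    ∃ m, E.Finalized j t m := by
  rcases eq_bot_or_hasFin_of_rFin h with rfl | ⟨b, hbj, s, hs⟩
  · exact ⟨m₀, Or.inl ⟨rfl, rfl⟩⟩
  · exact (exists_finalized_of_hasFin hs).imp fun m hm => hm.mono hbj.le

theorem not_hasFin_of_wPre (h : (E.client c j).phase = .wPre m t) :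
    ¬ HasFin ((E.state j).storage s) t := by
  intro hs
  obtain ⟨n, hrun, hn, ht⟩ := exists_running_write (E := E) (c := c) (j := j) (t := t) (m := m)
    (by rw [h]; rfl) (by rw [h]; rfl)
  obtain ⟨m', ⟨hbot, -⟩ | ⟨i, hij, c', hp⟩⟩ := exists_finalized_of_hasFin hs
  · exact ht.ne_bot hn hbot
  · obtain ⟨n', hrun', hn', ht'⟩ := exists_running_write (E := E) (c := c') (j := i) (t := t)
      (m := m') (by rw [hp]; rfl) (by rw [hp]; rfl)
    obtain rfl := ht.write_injective ht' hn hn'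
    cases hn.symm.trans hn'
    have hle := hrun.remaining_le hrun'.2.1 hij.le
    rw [h, hp] at hle
    exact absurd hle (by simp [Phase.remaining])

theorem label_eq_fin_of_mem_storage {d : Label} (h : ⟨t, none, d⟩ ∈ (E.state j).storage s) :
    d = .fin := by
  induction j generalizing t d with
  | zero => simp [E.init, initState] at h
  | succ j ih => exact ((E.step j).storageStep s).label_eq_fin_of_data_eq_none (fun _ _ => ih) h

theorem exists_tagged_of_mem_storage {w : K} {d : Label}
    (h : ⟨t, some w, d⟩ ∈ (E.state j).storage s) : ∃ m, E.Tagged t m ∧ w = encode α m s := by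
  induction j generalizing t d with
  | zero =>
    simp only [E.init, initState, Finset.mem_singleton, Rec.mk.injEq, Option.some.injEq] at h
    exact ⟨m₀, Or.inl ⟨h.1, rfl⟩, h.2.1⟩
  | succ j ih =>
    rcases ((E.step j).storageStep s).exists_mem_or_pre h with ⟨d', h⟩ | ⟨c, q, hreq⟩
    · exact ih h
    · obtain ⟨a, -, -, -, hreq⟩ := exists_sent_of_request_mem hreq
      obtain ⟨m, hp, hw⟩ := Phase.exists_eq_wPre_of_request hreq
      obtain ⟨n, -, hn, ht⟩ := exists_running_write (E := E) (c := c) (j := a + 1) (t := t)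
        (m := m) (by rw [hp]; rfl) (by rw [hp]; rfl)
      exact ⟨m, Or.inr ⟨n, c, hn, ht⟩, hw⟩

theorem Finalized.eq_encode_of_storedShare {w : K} (h : E.Finalized n t m)
    (hw : storedShare ((E.state j).storage s) t = some w) : w = encode α m s := by
  obtain ⟨d, hmem⟩ := exists_mem_of_storedShare_eq_some hw
  obtain ⟨m', hm', rfl⟩ := exists_tagged_of_mem_storage hmem
  rw [hm'.unique h.tagged]

variable (E) in
/-- At time `j`, a quorum of servers stores coded elements of tag `t`. -/
def ShareQuorum (j : ℕ) (t : Tag C) : Prop :=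
  ∃ Q : Finset (Fin N), quorumSize N k e ≤ Q.card ∧ ∀ s ∈ Q, HasShare ((E.state j).storage s) t

theorem ShareQuorum.mono (h : E.ShareQuorum i t) (hij : i ≤ j) : E.ShareQuorum j t :=
  let ⟨Q, hQ, hshare⟩ := h
  ⟨Q, hQ, fun s hs => hasShare_mono hij (hshare s hs)⟩

theorem shareQuorum_bot (hN : quorumSize N k e ≤ N) : E.ShareQuorum 0 ⊥ :=
  ⟨Finset.univ, by rwa [Finset.card_univ, Fintype.card_fin], fun s _ =>
    ⟨encode α m₀ s, .fin, by simp [E.init, initState]⟩⟩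

theorem shareQuorum_of_wPre (h : (E.client c j).phase = .wPre m t)
    (hq : (E.client c j).HasQuorum e) : E.ShareQuorum j t := by
  obtain ⟨n, hrun⟩ := exists_running (E := E) (c := c) (j := j) (by simp [h])
  obtain ⟨Q, hQ, hreplies⟩ := hq.exists_finset
  obtain ⟨a, -, -, -, haccess⟩ := hrun.exists_access
  refine ⟨Q, hQ, fun s hs => ?_⟩
  obtain ⟨r, hr⟩ := hreplies s hs
  obtain ⟨b, req, -, hbj, hreq, hhandles⟩ := haccess s r hr
  rw [h] at hreq
  cases hreq
  have hplaceholder : ∀ d, Rec.mk t none d ∉ (E.state b).storage s := fun d hd => by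
    obtain rfl := label_eq_fin_of_mem_storage hd
    exact not_hasFin_of_wPre h (hasFin_mono hbj.le ⟨none, hd⟩)
  refine hasShare_mono hbj ?_
  rw [hhandles.storage_eq]
  exact hasShare_storageAfter_pre hplaceholder _

theorem shareQuorum_of_wFin (h : (E.client c j).phase = .wFin m t) : E.ShareQuorum j t := by
  induction j with
  | zero => simp [client_zero] at h
  | succ j ih =>
    rcases (E.clientStep c j).of_wFin h with hp | ⟨hp, hq⟩
    · exact (ih hp).mono j.le_succ
    · exact (shareQuorum_of_wPre hp hq).mono j.le_succ

theorem Finalized.shareQuorum (h : E.Finalized n t m) (hN : quorumSize N k e ≤ N) :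
    E.ShareQuorum n t := by
  rcases h with ⟨rfl, -⟩ | ⟨j, hj, c, hp⟩
  · exact (shareQuorum_bot hN).mono n.zero_le
  · exact (shareQuorum_of_wFin hp).mono hj.le

theorem exists_validReply_of_rFin (h : (E.client c j).phase = .rFin t) :
    ∃ a < j, (E.client c (a + 1)).phase = .rFin t ∧
      ∀ s r, (E.client c j).replies s = some r →
        (E.client c j).shares t s = r.data ∧
          ∃ b > a, ValidReply M ((E.state b).storage s) s (.finR t) r := by
  obtain ⟨n, hrun⟩ := exists_running (E := E) (c := c) (j := j) (by simp [h])
  obtain ⟨a, haj, -, hphase, haccess⟩ := hrun.exists_access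
  refine ⟨a, haj, hphase.trans h, fun s r hr => ?_⟩
  obtain ⟨b, req, hab, -, hreq, hhandles⟩ := haccess s r hr
  rw [h] at hreq
  cases hreq
  exact ⟨Client.shares_eq_data hr hhandles.validReply.tag_eq hhandles.validReply.label_eq,
    b, hab, hhandles.validReply⟩

theorem le_numReceived_of_rFin (h : (E.client c j).phase = .rFin t)
    (hq : (E.client c j).HasQuorum e) : k + 2 * e ≤ numReceived ((E.client c j).shares t) := by
  obtain ⟨Q, hQ, hreplies⟩ := hq.exists_finset
  obtain ⟨a, -, hpa, hvalid⟩ := exists_validReply_of_rFin h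
  obtain ⟨m, hm⟩ := exists_finalized_of_rFin hpa
  have hN : quorumSize N k e ≤ N := hQ.trans (card_finset_fin_le Q)
  obtain ⟨Q', hQ', hshare⟩ := hm.shareQuorum hN
  refine (le_card_inter_of_quorumSize_le hQ' hQ).trans (Finset.card_le_card fun s hs => ?_)
  obtain ⟨hsQ', hsQ⟩ := Finset.mem_inter.1 hs
  obtain ⟨r, hr⟩ := hreplies s hsQ
  obtain ⟨hdata, b, hab, hrb⟩ := hvalid s r hr
  refine Finset.mem_filter.2 ⟨Finset.mem_univ s, ?_⟩
  rw [hdata]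
  exact hrb.data_ne_none (hasShare_mono hab (hshare s hsQ')).storedShare_ne_none

theorem numCorrupted_le_card_of_rFin (h : (E.client c j).phase = .rFin t)
    (hm : E.Finalized n t m) : numCorrupted α m ((E.client c j).shares t) ≤ M.card := by
  classical
  obtain ⟨a, -, -, hvalid⟩ := exists_validReply_of_rFin h
  refine Finset.card_le_card fun s hs => ?_
  obtain ⟨-, hreceived, hcorrupted⟩ := Finset.mem_filter.1 hs
  cases hr : (E.client c j).replies s with
  | none => exact absurd (by simp [Client.shares, hr]) hreceived
  | some r =>
    obtain ⟨hdata, b, -, rfl | ⟨hs, -⟩⟩ := hvalid s r hr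
    · obtain ⟨w, hw⟩ := Option.ne_none_iff_exists'.1 hreceived
      have hstored : storedShare ((E.state b).storage s) t = some w := hdata.symm.trans hw
      exact absurd (hw.trans (congrArg some (hm.eq_encode_of_storedShare hstored))) hcorrupted
    · exact hs

theorem read_decodes (hα : Function.Injective α) (hM : M.card ≤ e) {v : Option K}
    (h : E.act n = .retRead c v) :
    ∃ t m, (E.client c n).phase = .rFin t ∧ E.Finalized n t m ∧
      k + 2 * e ≤ numReceived ((E.client c n).shares t) ∧
      numCorrupted α m ((E.client c n).shares t) ≤ e ∧
      berlekampWelch α k e ((E.client c n).shares t) = some m ∧ v = some (secret m) := by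
  obtain ⟨-, hq, ⟨m, t, -, hact⟩ | ⟨t, hp, hact⟩⟩ := (E.clientStep c n).of_isRet (Or.inr ⟨v, h⟩)
  · cases h.symm.trans hact
  cases h.symm.trans hact
  obtain ⟨m, hm⟩ := exists_finalized_of_rFin hp
  have hreceived := le_numReceived_of_rFin hp hq
  have hcorrupted := (numCorrupted_le_card_of_rFin hp hm).trans hM
  have hdecoded := berlekampWelch_eq_some hα hreceived hcorrupted
  refine ⟨t, m, hp, hm, hreceived, hcorrupted, hdecoded, ?_⟩
  rw [Client.readResult, if_pos hreceived, hdecoded, Option.map_some]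

end Execution

/-! ### Atomicity -/

theorem exists_list_pairwise_lt {ι β : Type*} [LinearOrder β] {key : ι → β}
    (hkey : Function.Injective key) (S : Finset ι) :
    ∃ L : List ι, (∀ n, n ∈ L ↔ n ∈ S) ∧ L.Pairwise fun a b => key a < key b :=
  letI : LinearOrder ι := LinearOrder.lift' key hkey
  ⟨S.sort, fun _ => Finset.mem_sort _, S.sortedLT_sort.pairwise⟩

/-- The action is the invocation of a write. -/
def Action.IsWrite {N k : ℕ} {K C : Type*} (a : Action N k K C) : Prop := ∃ c m, a = .invWrite c m

theorem Action.apply_of_not_isWrite {N k : ℕ} [NeZero k] {K C : Type*} {a : Action N k K C}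
    (h : ¬ a.IsWrite) (x : K) : a.apply x = x := by
  cases a with
  | invWrite c m => exact absurd ⟨c, m, rfl⟩ h
  | _ => rfl

namespace Execution

variable {N k : ℕ} [NeZero k] {K C : Type*} [Field K] [LinearOrder C]
  {α : Fin N → K} {e : ℕ} {m₀ : Fin k → K} {M : Finset (Fin N)} {E : Execution C α e m₀ M}

theorem foldl_apply_of_not_isWrite {L : List ℕ} (h : ∀ j ∈ L, ¬ (E.act j).IsWrite) (x : K) :
    L.foldl (fun x j => (E.act j).apply x) x = x := by
  induction L with
  | nil => rfl
  | cons j L ih =>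
    rw [List.foldl_cons, Action.apply_of_not_isWrite (h j List.mem_cons_self)]
    exact ih fun i hi => h i (List.mem_cons_of_mem j hi)

theorem foldl_apply_eq_of_invWrite {A B : List ℕ} {w : ℕ} {c : C} {m : Fin k → K}
    (hw : E.act w = .invWrite c m) (hB : ∀ j ∈ B, ¬ (E.act j).IsWrite) (x : K) :
    (A ++ w :: B).foldl (fun x j => (E.act j).apply x) x = m 0 := by
  rw [List.foldl_append, List.foldl_cons, foldl_apply_of_not_isWrite hB, hw, Action.apply]

section AtomicTagging

variable {τ : Type*}

variable (E) in
open Classical in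
/-- The key by which operations are linearized: by tag, for equal tags with writes before reads,
and then by time of invocation. -/
noncomputable def opKey (tag : ℕ → τ) (n : ℕ) : τ ×ₗ Bool ×ₗ ℕ :=
  toLex (tag n, toLex (decide ¬ (E.act n).IsWrite, n))

theorem opKey_injective (tag : ℕ → τ) : Function.Injective (E.opKey tag) := fun _ _ h =>
  congrArg (fun x => (ofLex (ofLex x).2).2) h

variable [LinearOrder τ]

variable (E) in
/-- A tagging of the operations `ops`, which were invoked before time `T` and include all that
returned before `T`, from which atomicity can be read off: tags respect the order in which
operations follow each other in time, different writes have different tags, and a read returns the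
value of the write with its own tag, or the initial value if no write has a tag that small. -/
structure IsAtomicTagging (T : ℕ) (ops : Finset ℕ) (tag : ℕ → τ) : Prop where
  lt_and_isInv : ∀ n ∈ ops, n < T ∧ ∃ c, (E.act n).IsInv c
  mem_of_returns : ∀ n, ∀ n' < T, E.Returns n n' → n ∈ ops
  le_of_returns : ∀ a ∈ ops, ∀ b ∈ ops, ∀ a' < b, E.Returns a a' →
    tag a ≤ tag b ∧ ((E.act b).IsWrite → tag a < tag b)
  injOn_isWrite : Set.InjOn tag {n | n ∈ ops ∧ (E.act n).IsWrite}
  read : ∀ n, ∀ n' < T, ∀ c v, E.Returns n n' → E.act n' = .retRead c v →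
    ¬ (E.act n).IsWrite ∧
      ((v = some (m₀ 0) ∧ ∀ a ∈ ops, (E.act a).IsWrite → tag n < tag a) ∨
        ∃ a ∈ ops, ∃ c m, E.act a = .invWrite c m ∧ tag a = tag n ∧ v = some (m 0))

variable {tag : ℕ → τ} {a b n : ℕ}

theorem opKey_lt_iff : E.opKey tag a < E.opKey tag b ↔
    tag a < tag b ∨ tag a = tag b ∧ ((E.act a).IsWrite ∧ ¬ (E.act b).IsWrite ∨
      ((E.act a).IsWrite ↔ (E.act b).IsWrite) ∧ a < b) := by
  by_cases ha : (E.act a).IsWrite <;> by_cases hb : (E.act b).IsWrite <;>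
    simp [opKey, Prod.Lex.toLex_lt_toLex, ha, hb]

theorem tag_le_of_opKey_lt (h : E.opKey tag a < E.opKey tag b) : tag a ≤ tag b :=
  (opKey_lt_iff.1 h).elim le_of_lt fun h => h.1.le

namespace IsAtomicTagging

variable {T : ℕ} {ops : Finset ℕ}

theorem not_returns_of_opKey_lt (h : E.IsAtomicTagging T ops tag) (ha : a ∈ ops) (hb : b ∈ ops)
    (hab : E.opKey tag a < E.opKey tag b) : ¬ ∃ b', E.Returns b b' ∧ b' < a := by
  rintro ⟨b', hret, hlt⟩
  obtain ⟨hle, hwrite⟩ := h.le_of_returns b hb a ha b' hlt hret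
  have hba : b < a := hret.choose_spec.2.1.trans hlt
  rcases opKey_lt_iff.1 hab with htag | ⟨htag, ⟨haw, -⟩ | ⟨-, hlt⟩⟩
  · exact htag.not_ge hle
  · exact (hwrite haw).ne' htag
  · exact hlt.not_gt hba

theorem eq_foldl_of_read (h : E.IsAtomicTagging T ops tag) {L₁ L₂ : List ℕ}
    (hmem : ∀ j, j ∈ L₁ ++ n :: L₂ ↔ j ∈ ops)
    (hsorted : (L₁ ++ n :: L₂).Pairwise fun a b => E.opKey tag a < E.opKey tag b)
    {n' : ℕ} {c : C} {v : Option K} (hn' : n' < T) (hret : E.Returns n n')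
    (hact : E.act n' = .retRead c v) :
    v = some (L₁.foldl (fun x j => (E.act j).apply x) (m₀ 0)) := by
  obtain ⟨hsorted₁, hsorted₂, hbefore⟩ := List.pairwise_append.1 hsorted
  have hops : ∀ j ∈ L₁, j ∈ ops := fun j hj => (hmem j).1 (List.mem_append_left _ hj)
  have hle : ∀ j ∈ L₁, tag j ≤ tag n := fun j hj =>
    tag_le_of_opKey_lt (hbefore j hj n List.mem_cons_self)
  obtain ⟨hread, ⟨rfl, hinit⟩ | ⟨w, hwops, c', m, hw, htag, rfl⟩⟩ := h.read n n' hn' c v hret hact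
  · rw [foldl_apply_of_not_isWrite fun j hj hjw => (hinit j (hops j hj) hjw).not_ge (hle j hj)]
  have hww : (E.act w).IsWrite := ⟨c', m, hw⟩
  have hwn : E.opKey tag w < E.opKey tag n := opKey_lt_iff.2 (Or.inr ⟨htag, Or.inl ⟨hww, hread⟩⟩)
  have hwL : w ∈ L₁ := by
    rcases List.mem_append.1 ((hmem w).2 hwops) with hwL | hwL
    · exact hwL
    · rcases List.mem_cons.1 hwL with rfl | hwL
      · exact absurd hww hread
      · exact absurd hwn ((List.pairwise_cons.1 hsorted₂).1 w hwL).not_gt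
  obtain ⟨A, B, rfl⟩ := List.append_of_mem hwL
  rw [foldl_apply_eq_of_invWrite hw fun j hj hjw => ?_]
  have hjL : j ∈ A ++ w :: B := List.mem_append_right A (List.mem_cons_of_mem w hj)
  have hwj := (List.pairwise_cons.1 (List.pairwise_append.1 hsorted₁).2.1).1 j hj
  have hjtag : tag j = tag w :=
    le_antisymm ((hle j hjL).trans htag.ge) (tag_le_of_opKey_lt hwj)
  obtain rfl := h.injOn_isWrite ⟨hops j hjL, hjw⟩ ⟨hwops, hww⟩ hjtag
  exact lt_irrefl _ hwj

theorem linearizableUpTo (h : E.IsAtomicTagging T ops tag) : E.LinearizableUpTo T := by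
  obtain ⟨L, hL, hsorted⟩ := exists_list_pairwise_lt (opKey_injective (E := E) tag) ops
  refine ⟨L, hsorted.imp fun hab => ne_of_apply_ne _ hab.ne,
    fun n hn => h.lt_and_isInv n ((hL n).1 hn),
    fun n n' hn' hret => (hL n).2 (h.mem_of_returns n n' hn' hret),
    hsorted.imp_of_mem fun ha hb hab => h.not_returns_of_opKey_lt ((hL _).1 ha) ((hL _).1 hb) hab,
    ?_⟩
  rintro L₁ n L₂ rfl n' c v hn' hret hact
  exact h.eq_foldl_of_read hL hsorted hn' hret hact

end IsAtomicTagging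

end AtomicTagging

section OperationTags

variable {n n' : ℕ} {t : Tag C}

variable (E) in
open Classical in
/-- The tag that the operation invoked at time `n` selects (`⊥` if it selects none). -/
noncomputable def opTag (n : ℕ) : Tag C :=
  if h : ∃ t, E.SelectsTag n t then h.choose else ⊥

variable (E) in
open Classical in
/-- The operations invoked before time `T` that select a tag. -/
noncomputable def taggedOps (T : ℕ) : Finset ℕ :=
  (Finset.range T).filter fun n => ∃ t, E.SelectsTag n t

theorem SelectsTag.opTag_eq (h : E.SelectsTag n t) : E.opTag n = t := by
  have hex : ∃ t, E.SelectsTag n t := ⟨t, h⟩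
  rw [opTag, dif_pos hex]
  exact hex.choose_spec.unique h

theorem mem_taggedOps {T : ℕ} : n ∈ E.taggedOps T ↔ n < T ∧ E.SelectsTag n (E.opTag n) := by
  classical
  rw [taggedOps, Finset.mem_filter, Finset.mem_range]
  exact and_congr_right fun _ => ⟨fun ⟨t, ht⟩ => ht.opTag_eq ▸ ht, fun h => ⟨_, h⟩⟩

theorem Returns.running {c : C} (h : E.Returns n n') (hret : (E.act n').IsRet c) :
    E.Running c n n' := by
  obtain ⟨c', hinv, hlt, hret', hno⟩ := h
  obtain rfl := Action.Moves.client_unique (Or.inr (Or.inr hret)) (Or.inr (Or.inr hret'))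
  exact ⟨hinv, hlt, hno⟩

theorem Finalized.eq_bot_or_mem_taggedOps {m : Fin k → K} {T : ℕ} (h : E.Finalized n t m)
    (hn : n ≤ T) : (t = ⊥ ∧ m = m₀) ∨
      ∃ a ∈ E.taggedOps T, ∃ c, E.act a = .invWrite c m ∧ E.opTag a = t := by
  refine h.imp_right fun ⟨j, hj, c, hp⟩ => ?_
  obtain ⟨a, hrun, ha, ht⟩ := exists_running_write (E := E) (c := c) (j := j) (t := t) (m := m)
    (by rw [hp]; rfl) (by rw [hp]; rfl)
  have haT : a < T := hrun.2.1.trans (hj.trans_le hn)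
  exact ⟨a, mem_taggedOps.2 ⟨haT, ht.opTag_eq.symm ▸ ht⟩, c, ha, ht.opTag_eq⟩

theorem isAtomicTagging_opTag (hα : Function.Injective α) (hM : M.card ≤ e) (T : ℕ) :
    E.IsAtomicTagging T (E.taggedOps T) E.opTag where
  lt_and_isInv n hn :=
    let ⟨hnT, c, _, hrun, _⟩ := mem_taggedOps.1 hn
    ⟨hnT, c, hrun.1⟩
  mem_of_returns n n' hn' hret := by
    obtain ⟨t, ht, -⟩ := hret.exists_finQuorum
    have hnT : n < T := hret.choose_spec.2.1.trans hn'
    exact mem_taggedOps.2 ⟨hnT, ht.opTag_eq.symm ▸ ht⟩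
  le_of_returns a ha b hb a' hlt hret :=
    let ⟨hle, hwrite⟩ := (mem_taggedOps.1 ha).2.le_of_returns (mem_taggedOps.1 hb).2 hret hlt.le
    ⟨hle, fun ⟨c, m, hact⟩ => hwrite c m hact⟩
  injOn_isWrite := by
    rintro a ⟨ha, c, m, hact⟩ b ⟨hb, c', m', hact'⟩ htag
    exact (mem_taggedOps.1 ha).2.write_injective (htag ▸ (mem_taggedOps.1 hb).2) hact hact'
  read n n' hn' c v hret hact := by
    obtain ⟨t, m, hp, hfin, -, -, -, rfl⟩ := read_decodes hα hM hact
    have hrun := hret.running (Or.inr ⟨_, hact⟩)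
    have hread : E.act n = .invRead c := hrun.act_eq_invRead (by rw [hp]; rfl)
    have htag : E.opTag n = t := SelectsTag.opTag_eq ⟨c, n', hrun, by rw [hp]; rfl⟩
    refine ⟨by simp [hread, Action.IsWrite], ?_⟩
    rcases hfin.eq_bot_or_mem_taggedOps hn'.le with ⟨rfl, rfl⟩ | ⟨a, ha, c', hact', hta⟩
    · refine Or.inl ⟨rfl, fun a ha ⟨c', m, hw⟩ => ?_⟩
      rw [htag]
      exact bot_lt_iff_ne_bot.2 ((mem_taggedOps.1 ha).2.ne_bot hw)
    · exact Or.inr ⟨a, ha, c', m, hact', hta.trans htag.symm, rfl⟩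

theorem linearizableUpTo (hα : Function.Injective α) (hM : M.card ≤ e) (T : ℕ) :
    E.LinearizableUpTo T :=
  (isAtomicTagging_opTag hα hM T).linearizableUpTo

end OperationTags

end Execution

/-! ### Termination -/

namespace Execution

variable {N k : ℕ} [NeZero k] {K C : Type*} [Field K] [LinearOrder C]
  {α : Fin N → K} {e : ℕ} {m₀ : Fin k → K} {M : Finset (Fin N)} {E : Execution C α e m₀ M}
  {c : C} {f a i j n : ℕ}

theorem client_of_not_moves (hij : i ≤ j) (h : ∀ l, i ≤ l → ¬ (E.act l).Moves c) :
    (E.client c j).seq = (E.client c i).seq ∧ (E.client c j).phase = (E.client c i).phase ∧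
      ∀ s, (E.client c i).replies s ≠ none → (E.client c j).replies s ≠ none := by
  induction j, hij using Nat.le_induction with
  | base => exact ⟨rfl, rfl, fun _ => id⟩
  | succ j hij ih =>
    obtain ⟨hseq, hphase, hreplies⟩ := ih
    obtain ⟨hseq', hphase', hreplies'⟩ := (E.clientStep c j).of_not_moves (h j hij)
    exact ⟨hseq'.trans hseq, hphase'.trans hphase, fun s hs => hreplies' s (hreplies s hs)⟩

open Classical in
theorem CrashesAtMost.quorumSize_le_card (hf : E.CrashesAtMost f) (hN : k + 2 * (f + e) ≤ N) :
    quorumSize N k e ≤ (Finset.univ.filter fun i : Fin N => .inl i ∉ E.faulty).card := by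
  have hfaulty : (Finset.univ.filter fun i : Fin N => .inl i ∈ E.faulty).card ≤ f := by
    rw [← Set.ncard_coe_finset]
    simpa [CrashesAtMost] using hf
  have hsum := Finset.card_filter_add_card_filter_not
    (s := Finset.univ) fun i : Fin N => Sum.inl i ∈ E.faulty
  rw [Finset.card_univ, Fintype.card_fin] at hsum
  rw [quorumSize_le_iff]
  omega

namespace Fair

theorem exists_reply (hE : E.Fair) (hc : .inr c ∉ E.faulty) {s : Fin N} (hs : .inl s ∉ E.faulty)
    {req : Request K C} (hreq : Msg.request c s (E.client c j).seq req ∈ (E.state j).net)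
    (hseq : ∀ l ≥ j, (E.client c l).seq = (E.client c j).seq) :
    ∃ l ≥ j, (E.client c l).replies s ≠ none := by
  obtain ⟨l, hl, hact⟩ := hE.deliver j _ hreq hc hs
  obtain ⟨r, hr⟩ := (hact ▸ E.step l).exists_reply_of_deliver_request
  obtain ⟨l', hl', hact'⟩ := hE.deliver (l + 1) _ hr hs hc
  have hjl' : j ≤ l' := by omega
  exact ⟨l' + 1, by omega,
    (hact' ▸ E.step l').replies_ne_none_of_deliver_reply (hseq l' hjl').symm⟩

theorem exists_hasQuorum (hE : E.Fair) (hf : E.CrashesAtMost f) (hN : k + 2 * (f + e) ≤ N)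
    (hc : .inr c ∉ E.faulty) (hseq : (E.client c (a + 1)).seq = (E.client c a).seq + 1)
    (h : ∀ l > a, ¬ (E.act l).Moves c) : ∃ j > a, (E.client c j).HasQuorum e := by
  classical
  have hreply : ∀ s, ∃ l > a, .inl s ∉ E.faulty → (E.client c l).replies s ≠ none := by
    intro s
    by_cases hs : .inl s ∈ E.faulty
    · exact ⟨a + 1, by omega, fun hs' => absurd hs hs'⟩
    · obtain ⟨req, hreq⟩ := (E.step a).exists_request_mem hseq s
      obtain ⟨l, hl, hne⟩ := hE.exists_reply hc hs hreq fun l hl => (client_of_not_moves hl h).1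
      exact ⟨l, hl, fun _ => hne⟩
  choose l hl hreplies using hreply
  refine ⟨max (a + 1) (Finset.univ.sup l), by omega, (hf.quorumSize_le_card hN).trans ?_⟩
  refine Finset.card_le_card <| Finset.monotone_filter_right _ fun s _ hs => ?_
  have hls : l s ≤ max (a + 1) (Finset.univ.sup l) :=
    (Finset.le_sup (Finset.mem_univ s)).trans (le_max_right _ _)
  exact (client_of_not_moves hls fun j hj => h j ((hl s).trans_le hj)).2.2 s (hreplies s hs)

theorem exists_moves (hE : E.Fair) (hf : E.CrashesAtMost f) (hN : k + 2 * (f + e) ≤ N)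
    (hc : .inr c ∉ E.faulty) (hseq : (E.client c (a + 1)).seq = (E.client c a).seq + 1)
    (hp : (E.client c (a + 1)).phase ≠ .idle) : ∃ j > a, (E.act j).Moves c := by
  by_contra! h
  obtain ⟨j, hj, hq⟩ := hE.exists_hasQuorum hf hN hc hseq h
  have hpj : (E.client c j).phase ≠ .idle := (client_of_not_moves hj h).2.1 ▸ hp
  obtain ⟨l, hl, hmove⟩ := hE.progress j c hc hpj hq
  exact h l (hj.trans_le hl) (Or.inr hmove)

theorem exists_isRet (hE : E.Fair) (hf : E.CrashesAtMost f) (hN : k + 2 * (f + e) ≤ N)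
    (hc : .inr c ∉ E.faulty) (hrun : E.Running c n (a + 1))
    (hseq : (E.client c (a + 1)).seq = (E.client c a).seq + 1) : ∃ j > a, (E.act j).IsRet c := by
  induction hr : (E.client c (a + 1)).phase.remaining using Nat.strong_induction_on
    generalizing a with
  | _ r ih =>
    by_contra! hno
    have hrun' : ∀ j > a, E.Running c n j := fun j hj =>
      ⟨hrun.1, hrun.2.1.trans_le hj, fun l hnl _ hret =>
        (lt_or_ge a l).elim (fun hl => hno l hl hret) fun hl =>
          hrun.2.2 l hnl (Nat.lt_succ_of_le hl) hret⟩
    obtain ⟨j, hj, hinv | hadv | hret⟩ := hE.exists_moves hf hN hc hseq hrun.phase_ne_idle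
    · exact (hrun' j hj).not_isInv hinv
    · obtain ⟨hseq', hlt⟩ := (E.clientStep c j).of_advance hadv
      have hle := (hrun' j hj).remaining_le hrun.2.1 hj
      obtain ⟨l, hl, hret⟩ := ih _ (by omega) (hrun' (j + 1) (by omega)) hseq' rfl
      exact hno l (hj.trans hl) hret
    · exact hno j hj hret

theorem live (hE : E.Fair) (hf : E.CrashesAtMost f) (hN : k + 2 * (f + e) ≤ N) : E.Live := by
  intro n c hinv hc
  have hrun : E.Running c n (n + 1) := ⟨hinv, n.lt_succ_self, fun l hl hl' => by omega⟩
  obtain ⟨j, hj, hret⟩ :=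
    hE.exists_isRet hf hN hc hrun ((E.clientStep c n).of_isInv hinv).2.2.2
  exact (exists_returns_of_isRet hinv hj hret).imp fun _ => And.right

end Fair

end Execution

end CAS

theorem mainTheorem6_general {N k : ℕ} [NeZero k] {e : ℕ} {K : Type*} [Field K] {α : Fin N → K}
    (hα : Function.Injective α) {C : Type*} [LinearOrder C] {m₀ : Fin k → K} {M : Finset (Fin N)}
    (E : CAS.Execution C α e m₀ M) (hM : M.card ≤ e) :
    (∀ T, E.LinearizableUpTo T) ∧
    (∀ f, k + 2 * (f + e) ≤ N → E.CrashesAtMost f → E.Fair → E.Live) ∧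
    ∀ n c v, E.act n = .retRead c v →
      ∃ t m, ((E.state n).client c).phase = .rFin t ∧ E.Finalized n t m ∧
        k + 2 * e ≤ CAS.numReceived (((E.state n).client c).shares t) ∧
        CAS.numCorrupted α m (((E.state n).client c).shares t) ≤ e ∧
        CAS.berlekampWelch α k e (((E.state n).client c).shares t) = some m ∧
        v = some (CAS.secret m) :=
  ⟨CAS.Execution.linearizableUpTo hα hM, fun _ hN hf hfair => hfair.live hf hN,
    fun _ _ _ h => CAS.Execution.read_decodes hα hM h⟩

theorem mainTheorem6 {N k : ℕ} [NeZero k] (f e : ℕ) (hk : k ≤ N - 2 * (f + e))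
    {K : Type*} [Field K] [Finite K] (α : Fin N → K) (hα : Function.Injective α)
    (C : Type*) [LinearOrder C] (m₀ : Fin k → K) :
    CAS.Robust C α e m₀ f e ∧
    ∀ (M : Finset (Fin N)) (E : CAS.Execution C α e m₀ M), M.card ≤ e → E.CrashesAtMost f →
      ∀ n c v, E.act n = .retRead c v →
        ∃ t m, ((E.state n).client c).phase = .rFin t ∧ E.Finalized n t m ∧
          k + 2 * e ≤ CAS.numReceived (((E.state n).client c).shares t) ∧
          CAS.numCorrupted α m (((E.state n).client c).shares t) ≤ e ∧
          CAS.berlekampWelch α k e (((E.state n).client c).shares t) = some m ∧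
          v = some (CAS.secret m) := by
  have hN : k + 2 * (f + e) ≤ N := by have := NeZero.pos k; omega
  refine ⟨fun M E hM hf => ?_, fun M E hM _ => (mainTheorem6_general hα E hM).2.2⟩
  obtain ⟨hatomic, hlive, -⟩ := mainTheorem6_general hα E hM
  exact ⟨hatomic, hlive f hN hf⟩
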